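/- **Setting.** Let $\mathcal M$ be a compact two-dimensional Riemannian manifold, possibly with boundary and not necessarily connected, and let $T$ be a piecewise uniformly hyperbolic map of $\mathcal M$: there are finitely many pairwise disjoint open sets $\mathcal M_i^+$ with $\bigcup_i\overline{\mathcal M_i^+}=\mathcal M$, whose boundaries are finite unions of $\mathcal C^1$ curves of finite length; with $\mathcal M_i^-=T(\mathcal M_i^+)$ one has $\bigcup_i\overline{\mathcal M_i^-}=\mathcal M$; put $\mathcal S^\pm=\mathcal M\setminus\bigcup_i\mathcal M_i^\pm$; $T$ is a $\mathcal C^2$ diffeomorphism from $\mathcal M\setminus\mathcal S^+$ onto $\mathcal M\setminus\mathcal S^-$ and its restriction to each $\mathcal M_i^+$ extends to a $\mathcal C^2$ map on $\overline{\mathcal M_i^+}$; and there are continuous cone fields on $\mathcal M\setminus(\mathcal S^+\cup\partial\mathcal M)$, an unstable one strictly invariant under $DT$ and uniformly expanded by $DT$, and a stable one strictly invariant under $DT^{-1}$ and uniformly expanded by $DT^{-1}$. At a point $x$ whose forward trajectory avoids $\mathcal S^+\cup\partial\mathcal M$, the stable direction $E^s(x)$ is the set of tangent vectors all of whose forward images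 lie in the stable cones. Fix $\kappa>0$ and let $C^s(x)=\{u+v:\ u\in E^s(x),\ v\perp E^s(x),\ \|v\|\le\kappa\|u\|\}$. **Charts.** Fix finitely many coordinate charts $\chi_j:R_j\to\mathcal M$, of class $\mathcal C^2$ up to the boundary of $R_j$ (restrictions of $\mathcal C^2$ coordinate charts defined on a neighbourhood of $\overline{R_j}$). Each is attached to one $\mathcal M_i^+$, and either $R_j=(-r_j,r_j)^2$, mapped into $\mathcal M_i^+$, or $R_j$ is the part of $(-r_j,r_j)^2$ on one side of a piecewise $\mathcal C^1$ curve through the origin which $\chi_j$ maps to the boundary of $\mathcal M_i^+$ (or of $\mathcal M$). For a centre $y_j$ of $R_j$, $D\chi_j(y_j)$ is an isometry mapping $\mathbb R\times\{0\}$ onto $E^s(\chi_j(y_j))$; $\|D\chi_j\|$ and $\|(D\chi_j)^{-1}\|$ are at most $1+\kappa$ on $R_j$; for some $c_j\in(\kappa,2\kappa)$ and $C_j=\{(v_0,v_1):|v_1|\le c_j|v_0|\}$ one has $D\chi_j(y)C_j\supset C^s(\chi_j(y))$ and $DT^{-1}(D\chi_j(y)C_j)\subset C^s(T^{-1}\chi_j(y))$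 for all $y\in R_j$ with $\chi_j(y)\notin\mathcal S^-$ at which the stable directions involved are defined; and each $\mathcal M_i^+$ is covered by the sets $\chi_j(R_j\cap(-\frac{r_j}2,\frac{r_j}2)^2)$ over the charts attached to it. **Leaves.** Fix $0<r_0\le\frac12\min_j r_j$ and $B>0$. For $r\in(0,r_0]$ let $I_r=(-r,r)$. An admissible leaf is a curve $W=G(I_r)$, $G(t)=\chi_j(x+(t,F(t)))$, where $x\in R_j\cap(-\frac{r_j}2,\frac{r_j}2)^2$, $F\in\mathcal C^2([-r,r],\mathbb R)$, $F(0)=0$, $|F|_{\mathcal C^1}\le\kappa$, $|F|_{\mathcal C^2}\le B$, and $x+(t,F(t))\in R_j$ for $t\in I_r$. Let $\Sigma$ be the set of admissible leaves, $m$ the arc length on $W$ and $|W|=m(W)$. Norms on $\mathcal C^1(W)$ and $\mathcal C^q(W)$ (Hölder) are taken with respect to arc length, $\mathcal C^1(W,\mathbb C)$ consists of the $\mathcal C^1$ functions on $W$ of finite $\mathcal C^1$ norm, and $|\varphi|_{W,\alpha,q}=|W|^\alpha|\varphi|_{\mathcal C^q(W)}$. For two leaves $W_1,W_2$ in the same chart,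 with data $(x_i,r_i,F_i)$ and $r=\min(r_1,r_2)$, put $$d_\Sigma(W_1,W_2)=|x_1-x_2|+|r_1-r_2|+\tfrac1{2B}|F_1-F_2|_{\mathcal C^1(I_r)},\qquad d_q(\varphi_1,\varphi_2)=|\varphi_1\circ G_1-\varphi_2\circ G_2|_{\mathcal C^q(I_r)},$$ and $d_\Sigma=\infty$ for leaves in different charts. **Norms.** Let $0<\beta\le\alpha\le1-q$ with $q\ge0$ and $\alpha<1$, and let $\varepsilon_0,b>0$. For $h\in\mathcal C^1(\mathcal M,\mathbb C)$ put $$|h|_w=\sup_{W\in\Sigma}\ \sup_{|\varphi|_{\mathcal C^1(W)}\le1}\Big|\int_W h\varphi\,dm\Big|,\qquad \|h\|_s=\sup_{W\in\Sigma}\ \sup_{\varphi\in\mathcal C^1(W,\mathbb C),\ |\varphi|_{W,\alpha,q}\le1}\Big|\int_W h\varphi\,dm\Big|,$$ $$\|h\|_u=\sup_{0<\varepsilon\le\varepsilon_0}\ \sup_{d_\Sigma(W_1,W_2)\le\varepsilon}\ \sup_{\substack{|\varphi_i|_{\mathcal C^1(W_i)}\le1\\ d_q(\varphi_1,\varphi_2)\le\varepsilon}}\frac1{\varepsilon^\beta}\Big|\int_{W_1}h\varphi_1\,dm-\int_{W_2}h\varphi_2\,dm\Big|,\qquad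 \|h\|=\|h\|_s+b\|h\|_u .$$ Let $\mathcal B$ and $\mathcal B_w$ be the completions of $\mathcal C^1(\mathcal M,\mathbb C)$ (functions of finite norm) in the norms $\|\cdot\|$ and $|\cdot|_w$. **Lemma 3.5.** The unit ball of $\mathcal B$ is compactly embedded in $\mathcal B_w$: every $h\in\mathcal C^1(\mathcal M,\mathbb C)$ with $\|h\|<\infty$ has $|h|_w<\infty$, the identity on these functions extends to an injective continuous linear map $\iota:\mathcal B\to\mathcal B_w$, and the image under $\iota$ of the closed unit ball of $\mathcal B$ has compact closure in $\mathcal B_w$. -/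

import Mathlib

open Set MeasureTheory Manifold Bundle
open scoped ENNReal ContDiff Topology

noncomputable section

/-- The Euclidean plane. -/
abbrev Plane : Type := EuclideanSpace ℝ (Fin 2)

/-! ### Extended seminorms and completions -/

/-- A seminorm on a complex vector space that may take the value `∞`. -/
structure IsExtSeminorm {V : Type*} [AddCommGroup V] [Module ℂ V] (N : V → ℝ≥0∞) : Prop where
  add_le : ∀ x y, N (x + y) ≤ N x + N y
  smul : ∀ (c : ℂ) (x), N (c • x) = ‖c‖ₑ * N x

namespace IsExtSeminorm

variable {V : Type*} [AddCommGroup V] [Module ℂ V] {N N' : V → ℝ≥0∞}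

theorem zero (hN : IsExtSeminorm N) : N 0 = 0 := by
  simpa using hN.smul 0 0

theorem neg (hN : IsExtSeminorm N) (x : V) : N (-x) = N x := by
  simpa using hN.smul (-1) x

theorem iSup {ι : Sort*} {f : ι → V → ℝ≥0∞} (h : ∀ i, IsExtSeminorm (f i)) :
    IsExtSeminorm (fun x => ⨆ i, f i x) where
  add_le x y := iSup_le fun i => ((h i).add_le x y).trans
    (add_le_add (le_iSup (fun i => f i x) i) (le_iSup (fun i => f i y) i))
  smul c x := by simp only [(h _).smul, ENNReal.mul_iSup]

theorem add (hN : IsExtSeminorm N) (hN' : IsExtSeminorm N') :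
    IsExtSeminorm (fun x => N x + N' x) where
  add_le x y := (add_le_add (hN.add_le x y) (hN'.add_le x y)).trans
    (le_of_eq (add_add_add_comm _ _ _ _))
  smul c x := by rw [hN.smul, hN'.smul, mul_add]

theorem const_mul (hN : IsExtSeminorm N) (a : ℝ≥0∞) : IsExtSeminorm (fun x => a * N x) where
  add_le x y := by
    rw [← mul_add]
    exact mul_le_mul_right (hN.add_le x y) a
  smul c x := by rw [hN.smul, mul_left_comm]

theorem of_linear (l : V →ₗ[ℂ] ℂ) : IsExtSeminorm (fun x => ‖l x‖ₑ) where
  add_le x y := by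
    rw [map_add]
    exact enorm_add_le _ _
  smul c x := by rw [map_smul, smul_eq_mul, enorm_mul]

/-- The vectors of finite norm. -/
def finiteSubmodule (hN : IsExtSeminorm N) : Submodule ℂ V where
  carrier := {x | N x < ⊤}
  add_mem' {x y} hx hy := (hN.add_le x y).trans_lt (ENNReal.add_lt_top.2 ⟨hx, hy⟩)
  zero_mem' := by simp [hN.zero]
  smul_mem' c x hx := by
    simp only [Set.mem_ofPred_eq, hN.smul]
    exact ENNReal.mul_lt_top enorm_lt_top hx

/-- The space of vectors of finite norm, as a type that carries only the seminorm `N`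
(and no other topology). -/
def FinitePart (hN : IsExtSeminorm N) : Type _ := hN.finiteSubmodule

instance (hN : IsExtSeminorm N) : AddCommGroup hN.FinitePart :=
  inferInstanceAs (AddCommGroup hN.finiteSubmodule)

instance (hN : IsExtSeminorm N) : Module ℂ hN.FinitePart :=
  inferInstanceAs (Module ℂ hN.finiteSubmodule)

/-- A vector of finite norm, as an element of `FinitePart`. -/
def toFinitePart (hN : IsExtSeminorm N) (x : V) (hx : N x < ⊤) : hN.FinitePart := ⟨x, hx⟩

/-- The underlying vector. -/
def val (hN : IsExtSeminorm N) (x : hN.FinitePart) : V := Subtype.val x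

/-- `N` as a real-valued seminorm on the space of vectors of finite norm. -/
def toSeminorm (hN : IsExtSeminorm N) : Seminorm ℂ hN.FinitePart :=
  Seminorm.of (fun x => (N (hN.val x)).toReal)
    (fun x y => by
      have hx : N (hN.val x) ≠ ⊤ := (show N (hN.val x) < ⊤ from Subtype.prop x).ne
      have hy : N (hN.val y) ≠ ⊤ := (show N (hN.val y) < ⊤ from Subtype.prop y).ne
      rw [← ENNReal.toReal_add hx hy]
      exact ENNReal.toReal_mono (ENNReal.add_ne_top.2 ⟨hx, hy⟩) (hN.add_le _ _))
    (fun c x => by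
      have : N (hN.val (c • x)) = ‖c‖ₑ * N (hN.val x) := hN.smul c _
      rw [this, ENNReal.toReal_mul, toReal_enorm])

instance (hN : IsExtSeminorm N) : SeminormedAddCommGroup hN.FinitePart :=
  hN.toSeminorm.toAddGroupSeminorm.toSeminormedAddCommGroup

theorem norm_eq (hN : IsExtSeminorm N) (x : hN.FinitePart) : ‖x‖ = (N (hN.val x)).toReal := rfl

instance (hN : IsExtSeminorm N) : NormedSpace ℂ hN.FinitePart where
  norm_smul_le c x := le_of_eq (map_smul_eq_mul hN.toSeminorm c x)

/-- The Banach space obtained by completing with respect to `N`. (Vectors with `N x = ∞` are at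
infinite distance from `0`, so leaving them out does not change the balls around `0`.) -/
abbrev Completed (hN : IsExtSeminorm N) : Type _ := UniformSpace.Completion hN.FinitePart

end IsExtSeminorm

/-! ### Piecewise hyperbolic maps -/

section Setting

variable {H : Type*} [TopologicalSpace H] (I : ModelWithCorners ℝ Plane H)
  (M : Type*) [TopologicalSpace M] [ChartedSpace H M]

/-- `S` is a finite union of `C¹` curves (parametrized by `[0,1]`, hence of finite length). -/
def IsPiecewiseC1Curve {E' : Type*} [NormedAddCommGroup E'] [NormedSpace ℝ E']
    {H' : Type*} [TopologicalSpace H'] (J : ModelWithCorners ℝ E' H')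
    {N : Type*} [TopologicalSpace N] [ChartedSpace H' N] (S : Set N) : Prop :=
  ∃ (n : ℕ) (γ : Fin n → ℝ → N), (∀ k, ContMDiffOn 𝓘(ℝ, ℝ) J 1 (γ k) (Icc 0 1)) ∧
    S = ⋃ k, γ k '' Icc 0 1

/-- A closed (double) sector in a two-dimensional vector space. -/
def IsSector {V : Type*} [AddCommGroup V] [Module ℝ V] (C : Set V) : Prop :=
  ∃ u w : V, LinearIndependent ℝ ![u, w] ∧ C = {v | ∃ a b : ℝ, 0 ≤ a * b ∧ v = a • u + b • w}

variable {M} [IsManifold I ∞ M]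

/-- A continuous field of cones, defined over the set `D`. -/
structure IsConeField (D : Set M) (C : (x : M) → Set (TangentSpace I x)) : Prop where
  sector : ∀ x ∈ D, IsSector (C x)
  isOpen_interior : IsOpen {p : TangentBundle I M | p.proj ∈ D ∧ p.snd ∈ interior (C p.proj)}
  isOpen_compl : IsOpen {p : TangentBundle I M | p.proj ∈ D ∧ p.snd ∉ C p.proj}

variable (M)
variable [RiemannianBundle (fun x : M => TangentSpace I x)]

/-- A piecewise `C²` uniformly hyperbolic map of the surface `M`. The values of `toFun` outside
the union of the open pieces play no role. -/
structure PiecewiseHyperbolicMap where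
  toFun : M → M
  numPieces : ℕ
  /-- the regions `M_i⁺` -/
  piece : Fin numPieces → Set M
  isOpen_piece : ∀ i, IsOpen (piece i)
  disjoint_piece : ∀ i j, i ≠ j → Disjoint (piece i) (piece j)
  closure_piece : ⋃ i, closure (piece i) = univ
  frontier_piece : ∀ i, IsPiecewiseC1Curve I (frontier (piece i))
  closure_image : ⋃ i, closure (toFun '' piece i) = univ
  /-- `toFun` is a `C²` diffeomorphism from the union of the `M_i⁺` onto that of the images -/
  contMDiffOn : ContMDiffOn I I 2 toFun (⋃ i, piece i)
  exists_inverse : ∃ S : M → M, LeftInvOn S toFun (⋃ i, piece i) ∧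
    ContMDiffOn I I 2 S (toFun '' ⋃ i, piece i)
  exists_extension : ∀ i, ∃ T' : M → M, EqOn T' toFun (piece i) ∧
    ContMDiffOn I I 2 T' (closure (piece i))
  stableCone : (x : M) → Set (TangentSpace I x)
  unstableCone : (x : M) → Set (TangentSpace I x)
  stable_isConeField : IsConeField I ((⋃ i, piece i) \ I.boundary M) stableCone
  unstable_isConeField : IsConeField I ((⋃ i, piece i) \ I.boundary M) unstableCone
  unstable_invariant : ∀ x ∈ (⋃ i, piece i) \ I.boundary M,
    toFun x ∈ (⋃ i, piece i) \ I.boundary M → ∀ v ∈ unstableCone x, v ≠ 0 →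
      mfderiv I I toFun x v ∈ interior (unstableCone (toFun x))
  stable_invariant : ∀ x ∈ (⋃ i, piece i) \ I.boundary M,
    toFun x ∈ (⋃ i, piece i) \ I.boundary M → ∀ v : TangentSpace I x, v ≠ 0 →
      mfderiv I I toFun x v ∈ stableCone (toFun x) → v ∈ interior (stableCone x)
  unstable_expansion : ∃ lam : ℝ, 1 < lam ∧ ∀ x ∈ (⋃ i, piece i) \ I.boundary M,
    ∀ v ∈ unstableCone x, lam * ‖v‖ ≤ ‖mfderiv I I toFun x v‖
  /-- `DT⁻¹` uniformly expands the stable cones; as these are invariant under `DT⁻¹`, the vectors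
  concerned lie in stable cones too, and `DT` contracts them -/
  stable_contraction : ∃ mu : ℝ, 0 < mu ∧ mu < 1 ∧ ∀ x ∈ ⋃ i, piece i,
    toFun x ∈ (⋃ i, piece i) \ I.boundary M → ∀ v : TangentSpace I x,
      mfderiv I I toFun x v ∈ stableCone (toFun x) → ‖mfderiv I I toFun x v‖ ≤ mu * ‖v‖

variable {I M}

namespace PiecewiseHyperbolicMap

variable (T : PiecewiseHyperbolicMap I M)

/-- The set `M \ S⁺` where the map is smooth. -/
def regular : Set M := ⋃ i, T.piece i

/-- The singularity set `S⁻` of the inverse map. -/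
def singularBackward : Set M := (T.toFun '' T.regular)ᶜ

/-- The points whose forward trajectory meets neither a singularity nor the boundary of `M`. -/
def good : Set M := {x | ∀ n : ℕ, T.toFun^[n] x ∈ T.regular \ I.boundary M}

/-- The stable direction `E^s(x)`, for `x` in `good`: the vectors all of whose forward images
lie in the stable cones. -/
def stableDir (x : M) : Set (TangentSpace I x) :=
  {v | ∀ n : ℕ, mfderiv I I (T.toFun^[n]) x v ∈ T.stableCone (T.toFun^[n] x)}

/-- The narrow cone of width `κ` around the stable direction. -/
def narrowStableCone (κ : ℝ) (x : M) : Set (TangentSpace I x) :=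
  {w | ∃ u ∈ T.stableDir x, ∃ v : TangentSpace I x,
    (∀ u' ∈ T.stableDir x, inner ℝ u' v = 0) ∧ ‖v‖ ≤ κ * ‖u‖ ∧ w = u + v}

end PiecewiseHyperbolicMap

/-- The open square `(-r, r)²`. -/
def openSquare (r : ℝ) : Set Plane := {y | ∀ k, |y k| < r}

/-- The horizontal cone of slope `c`. -/
def horizontalCone (c : ℝ) : Set Plane := {v | |v 1| ≤ c * |v 0|}

/-- `R` is what remains of the square `(-r, r)²` on one side of the piecewise `C¹` curve `Γ`
passing through the origin; points of `Γ` itself may or may not be included in `R`. -/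
def IsOneSideOf (r : ℝ) (Γ R : Set Plane) : Prop :=
  IsPiecewiseC1Curve 𝓘(ℝ, Plane) Γ ∧ (0 : Plane) ∈ Γ ∧
  ∃ y ∈ openSquare r \ Γ, connectedComponentIn (openSquare r \ Γ) y ⊆ R ∧
    R ⊆ openSquare r ∩ closure (connectedComponentIn (openSquare r \ Γ) y)

/-- A finite family of coordinate charts adapted to the stable direction of `T`. The chart `χ_j` is
used on `R_j = dom j`, and it is `C²` up to the boundary of `R_j`: it is the restriction of a `C²`
coordinate chart with a domain `ext j` that contains the closure of `R_j`. (When the image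
meets the boundary of `M`, the set `ext j` is not open.) -/
structure LeafCharts (T : PiecewiseHyperbolicMap I M) (κ : ℝ) where
  num : ℕ
  /-- the index `i` of the region `M_i⁺` for which the chart is chosen -/
  pieceOf : Fin num → Fin T.numPieces
  chart : Fin num → Plane → M
  radius : Fin num → ℝ
  radius_pos : ∀ j, 0 < radius j
  dom : Fin num → Set Plane
  ext : Fin num → Set Plane
  closure_dom_subset : ∀ j, closure (dom j) ⊆ ext j
  isOpen_image : ∀ j, IsOpen (chart j '' ext j)
  contMDiffOn : ∀ j, ContMDiffOn 𝓘(ℝ, Plane) I 2 (chart j) (ext j)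
  exists_inverse : ∀ j, ∃ ξ : M → Plane, LeftInvOn ξ (chart j) (ext j) ∧
    ContMDiffOn I 𝓘(ℝ, Plane) 2 ξ (chart j '' ext j)
  /-- either a full square mapped into `M_i⁺`, or one side of (the preimage of) a part of the
  boundary of `M_i⁺` -/
  shape : ∀ j, (dom j = openSquare (radius j) ∧ chart j '' dom j ⊆ T.piece (pieceOf j)) ∨
    (chart j '' dom j ⊆ closure (T.piece (pieceOf j)) ∧
      ∃ Γ : Set Plane, IsOneSideOf (radius j) Γ (dom j) ∧
        chart j '' (Γ ∩ closure (dom j)) ⊆ frontier (T.piece (pieceOf j)) ∪ I.boundary M)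
  /-- the centre `y_j` of `R_j` (any point may serve) -/
  centre : Fin num → Plane
  centre_mem : ∀ j, centre j ∈ ext j
  isometry_centre : ∀ j, ∀ v : Plane,
    ‖mfderivWithin 𝓘(ℝ, Plane) I (chart j) (ext j) (centre j) v‖ = ‖v‖
  good_centre : ∀ j, chart j (centre j) ∈ T.good
  stable_centre : ∀ j, mfderivWithin 𝓘(ℝ, Plane) I (chart j) (ext j) (centre j) ''
    {v : Plane | v 1 = 0} = T.stableDir (chart j (centre j))
  norm_deriv_le : ∀ j, ∀ y ∈ dom j, ∀ v : Plane,
    ‖mfderivWithin 𝓘(ℝ, Plane) I (chart j) (ext j) y v‖ ≤ (1 + κ) * ‖v‖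
  le_norm_deriv : ∀ j, ∀ y ∈ dom j, ∀ v : Plane,
    ‖v‖ ≤ (1 + κ) * ‖mfderivWithin 𝓘(ℝ, Plane) I (chart j) (ext j) y v‖
  /-- the slope `c_j` of the cone `C_j` -/
  slope : Fin num → ℝ
  slope_mem : ∀ j, slope j ∈ Ioo κ (2 * κ)
  cone_contains : ∀ j, ∀ y ∈ dom j, chart j y ∉ T.singularBackward → chart j y ∈ T.good →
    T.narrowStableCone κ (chart j y) ⊆
      mfderivWithin 𝓘(ℝ, Plane) I (chart j) (ext j) y '' horizontalCone (slope j)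
  /-- `DT⁻¹` maps the image of `C_j` into the stable cone: if `DT p = Dχ_j(y) v` with `v ∈ C_j`, then
  the tangent vector `p` lies in the stable cone at its base point -/
  cone_invariant : ∀ j, ∀ y ∈ dom j, ∀ v ∈ horizontalCone (slope j), ∀ p : TangentBundle I M,
    p.proj ∈ T.regular → p.proj ∈ T.good →
    tangentMap I I T.toFun p =
      tangentMapWithin 𝓘(ℝ, Plane) I (chart j) (ext j) ⟨y, v⟩ →
    p.snd ∈ T.narrowStableCone κ p.proj
  cover : ∀ i, T.piece i ⊆
    ⋃ j ∈ {j | pieceOf j = i}, chart j '' (dom j ∩ openSquare (radius j / 2))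

/-! ### Norms of functions on intervals `(-r, r)` -/

/-- The `C¹` norm on `(-r, r)`. -/
def intervalC1Norm {F : Type*} [NormedAddCommGroup F] [NormedSpace ℝ F] (r : ℝ) (f : ℝ → F) :
    ℝ≥0∞ :=
  (⨆ t ∈ Ioo (-r) r, ‖f t‖ₑ) + ⨆ t ∈ Ioo (-r) r, ‖deriv f t‖ₑ

/-- The `C²` norm on `(-r, r)`. -/
def intervalC2Norm {F : Type*} [NormedAddCommGroup F] [NormedSpace ℝ F] (r : ℝ) (f : ℝ → F) :
    ℝ≥0∞ :=
  intervalC1Norm r f + ⨆ t ∈ Ioo (-r) r, ‖deriv (deriv f) t‖ₑ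

/-- The `C^q` (Hölder) norm on `(-r, r)`, with respect to a distance `d`. -/
def intervalHolderNorm (r q : ℝ) (d : ℝ → ℝ → ℝ≥0∞) (f : ℝ → ℂ) : ℝ≥0∞ :=
  (⨆ t ∈ Ioo (-r) r, ‖f t‖ₑ) +
    ⨆ s ∈ Ioo (-r) r, ⨆ t ∈ Ioo (-r) r, ⨆ _ : s ≠ t, ‖f s - f t‖ₑ / d s t ^ q

/-! ### Admissible leaves -/

/-- An admissible leaf `W = G(x, r, F)(I_r)`, recorded by its chart, centre, radius and graph. -/
structure AdmissibleLeaf {T : PiecewiseHyperbolicMap I M} {κ : ℝ} (A : LeafCharts T κ)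
    (r₀ B : ℝ) where
  j : Fin A.num
  x : Plane
  r : ℝ
  F : ℝ → ℝ
  x_mem : x ∈ A.dom j ∩ openSquare (A.radius j / 2)
  r_pos : 0 < r
  r_le : r ≤ r₀
  contDiffOn : ContDiffOn ℝ 2 F (Icc (-r) r)
  F_zero : F 0 = 0
  F_C1 : intervalC1Norm r F ≤ ENNReal.ofReal κ
  F_C2 : intervalC2Norm r F ≤ ENNReal.ofReal B
  graph_mem : ∀ t ∈ Ioo (-r) r, x + !₂[t, F t] ∈ A.dom j

namespace AdmissibleLeaf

variable {T : PiecewiseHyperbolicMap I M} {κ : ℝ} {A : LeafCharts T κ} {r₀ B : ℝ}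
  (W W₁ W₂ : AdmissibleLeaf A r₀ B)

/-- The graph of `F`, based at `x`. -/
def graph (t : ℝ) : Plane := W.x + !₂[t, W.F t]

/-- The parametrization `G(x, r, F)(t) = χ_j(x + (t, F(t)))`. -/
def param (t : ℝ) : M := A.chart W.j (W.graph t)

/-- The length of the velocity of the parametrization. -/
def speed (t : ℝ) : ℝ := ‖mfderiv 𝓘(ℝ, ℝ) I W.param t (1 : ℝ)‖

/-- The distance along the leaf between the points with parameters `s` and `t`. -/
def arcDist (s t : ℝ) : ℝ≥0∞ := pathELength I W.param (min s t) (max s t)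

/-- The length `|W|`. -/
def length : ℝ≥0∞ := pathELength I W.param (-W.r) W.r

/-- `∫_W h φ dm`, where `m` is the arc length. -/
def integral (h φ : M → ℂ) : ℂ :=
  ∫ t in Ioo (-W.r) W.r, h (W.param t) * φ (W.param t) * (W.speed t : ℂ)

/-- The `C¹` norm on the leaf, the derivative being taken with respect to arc length. Here and below,
a function on the leaf is written as a function on `M`, whose values off the leaf play no role. -/
def c1Norm (φ : M → ℂ) : ℝ≥0∞ :=
  (⨆ t ∈ Ioo (-W.r) W.r, ‖φ (W.param t)‖ₑ) +
    ⨆ t ∈ Ioo (-W.r) W.r, ‖deriv (φ ∘ W.param) t‖ₑ / ENNReal.ofReal (W.speed t)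

/-- The space `C¹(W, ℂ)`. -/
def c1Functions : Set (M → ℂ) :=
  {φ | ContDiffOn ℝ 1 (φ ∘ W.param) (Ioo (-W.r) W.r) ∧ W.c1Norm φ < ⊤}

/-- The `C^q` (Hölder) norm on the leaf, with respect to the distance along the leaf. -/
def holderNorm (q : ℝ) (φ : M → ℂ) : ℝ≥0∞ :=
  intervalHolderNorm W.r q W.arcDist (φ ∘ W.param)

/-- The distance `d_Σ` between two leaves. -/
def leafDist : ℝ≥0∞ :=
  (if W₁.j = W₂.j then 0 else ⊤) + ‖W₁.x - W₂.x‖ₑ + ‖W₁.r - W₂.r‖ₑ +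
    ENNReal.ofReal (2⁻¹ * B⁻¹) *
      intervalC1Norm (min W₁.r W₂.r) (fun t => W₁.F t - W₂.F t)

/-- The distance `d_q` between functions on two leaves. -/
def testDist (q : ℝ) (φ₁ φ₂ : M → ℂ) : ℝ≥0∞ :=
  intervalHolderNorm (min W₁.r W₂.r) q edist (fun t => φ₁ (W₁.param t) - φ₂ (W₂.param t))

section Integrability

theorem graph_contDiffOn :
    ContDiffOn ℝ 2 W.graph (Ioo (-W.r) W.r) := by
  refine contDiffOn_const.add ?_
  rw [contDiffOn_euclidean]
  intro i
  fin_cases i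
  · exact contDiffOn_id
  · exact W.contDiffOn.mono Ioo_subset_Icc_self

theorem dom_subset_ext : A.dom W.j ⊆ A.ext W.j :=
  subset_closure.trans (A.closure_dom_subset W.j)

theorem param_contMDiffOn : ContMDiffOn 𝓘(ℝ, ℝ) I 2 W.param (Ioo (-W.r) W.r) :=
  (A.contMDiffOn W.j).comp (contMDiffOn_iff_contDiffOn.2 W.graph_contDiffOn)
    (fun t ht => W.dom_subset_ext (W.graph_mem t ht))

theorem speed_continuousOn [IsContMDiffRiemannianBundle I ∞ Plane (fun x : M => TangentSpace I x)] :
    ContinuousOn W.speed (Ioo (-W.r) W.r) := by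
  have : IsContinuousRiemannianBundle Plane (fun x : M => TangentSpace I x) := by
    obtain ⟨g, hg, hg'⟩ := IsContMDiffRiemannianBundle.exists_contMDiff (IB := I) (n := ∞)
      (F := Plane) (E := fun x : M => TangentSpace I x)
    exact ⟨g, hg.continuous, hg'⟩
  have h1 := W.param_contMDiffOn.continuousOn_tangentMapWithin (by norm_num)
    (isOpen_Ioo.uniqueMDiffOn)
  have h2 : ContinuousOn (fun t : ℝ => (⟨t, (1 : ℝ)⟩ : TangentBundle 𝓘(ℝ, ℝ) ℝ))
      (Ioo (-W.r) W.r) := by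
    have : Continuous (fun t : ℝ =>
        (tangentBundleModelSpaceHomeomorph 𝓘(ℝ, ℝ)).symm (t, (1 : ℝ))) := by
      fun_prop
    exact this.continuousOn
  have h3 := h1.comp h2 (fun t ht => ht)
  have h4 := ContinuousOn.inner_bundle (F := Plane) (E := fun x : M => TangentSpace I x) h3 h3
  refine (Real.continuous_sqrt.comp_continuousOn h4).congr fun t ht => ?_
  have h5 : mfderivWithin 𝓘(ℝ, ℝ) I W.param (Ioo (-W.r) W.r) t = mfderiv 𝓘(ℝ, ℝ) I W.param t :=
    mfderivWithin_of_isOpen isOpen_Ioo ht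
  simp only [Function.comp_apply, speed]
  rw [h5]
  exact norm_eq_sqrt_real_inner _

theorem speed_le {t : ℝ} (ht : t ∈ Ioo (-W.r) W.r) :
    W.speed t ≤ (1 + κ) * ‖fderiv ℝ W.graph t 1‖ := by
  have hy : W.graph t ∈ A.dom W.j := W.graph_mem t ht
  have h1 : HasMFDerivWithinAt 𝓘(ℝ, Plane) I (A.chart W.j) (A.ext W.j) (W.graph t)
      (mfderivWithin 𝓘(ℝ, Plane) I (A.chart W.j) (A.ext W.j) (W.graph t)) :=
    (((A.contMDiffOn W.j) _ (W.dom_subset_ext hy)).mdifferentiableWithinAt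
      (by norm_num)).hasMFDerivWithinAt
  have h2 : HasMFDerivWithinAt 𝓘(ℝ, ℝ) 𝓘(ℝ, Plane) W.graph
      (Ioo (-W.r) W.r) t (fderiv ℝ W.graph t) := by
    have := ((W.graph_contDiffOn.contDiffAt (isOpen_Ioo.mem_nhds ht)).differentiableAt
      (by norm_num)).hasFDerivAt
    exact this.hasMFDerivAt.hasMFDerivWithinAt
  have h3 := (h1.comp t h2 (fun s hs => W.dom_subset_ext (W.graph_mem s hs))).hasMFDerivAt
    (isOpen_Ioo.mem_nhds ht)
  have h4 : mfderiv 𝓘(ℝ, ℝ) I W.param t = _ := h3.mfderiv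
  rw [speed, h4]
  exact A.norm_deriv_le W.j _ hy _

theorem norm_deriv_F_le {t : ℝ} (hκ : 0 < κ) (ht : t ∈ Ioo (-W.r) W.r) : ‖deriv W.F t‖ ≤ κ := by
  have h : ‖deriv W.F t‖ₑ ≤ ENNReal.ofReal κ :=
    ((le_iSup₂ (f := fun t (_ : t ∈ Ioo (-W.r) W.r) => ‖deriv W.F t‖ₑ) t ht).trans
      le_add_self).trans W.F_C1
  rw [← ofReal_norm] at h
  exact (ENNReal.ofReal_le_ofReal_iff hκ.le).1 h

theorem fderiv_graph {t : ℝ} (ht : t ∈ Ioo (-W.r) W.r) :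
    fderiv ℝ W.graph t 1 = !₂[1, deriv W.F t] := by
  have hF : HasDerivAt W.F (deriv W.F t) t :=
    ((W.contDiffOn.contDiffAt (Icc_mem_nhds ht.1 ht.2)).differentiableAt
      (by norm_num)).hasDerivAt
  have : HasDerivAt W.graph !₂[1, deriv W.F t] t := by
    refine HasDerivAt.const_add _ ?_
    rw [hasDerivAt_iff_hasFDerivAt, ← hasFDerivWithinAt_univ, hasFDerivWithinAt_euclidean]
    intro i
    rw [hasFDerivWithinAt_univ]
    fin_cases i
    · exact (hasDerivAt_id t).hasFDerivAt.congr_fderiv (by ext; simp)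
    · exact hF.hasFDerivAt.congr_fderiv (by ext; simp)
  exact this.deriv

theorem speed_le_const {t : ℝ} (hκ : 0 < κ) (ht : t ∈ Ioo (-W.r) W.r) :
    W.speed t ≤ (1 + κ) * (1 + κ) := by
  refine (W.speed_le ht).trans (mul_le_mul_of_nonneg_left ?_ (by positivity))
  rw [W.fderiv_graph ht, EuclideanSpace.norm_eq]
  have := W.norm_deriv_F_le hκ ht
  apply Real.sqrt_le_iff.2 ⟨by positivity, ?_⟩
  simp only [Fin.sum_univ_two]
  have h0 := norm_nonneg (deriv W.F t)
  have h1 : ‖deriv W.F t‖ ^ 2 ≤ κ ^ 2 := pow_le_pow_left₀ h0 this 2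
  simp at h1 ⊢
  nlinarith

theorem enorm_le_of_c1Norm_lt {φ : M → ℂ} (hφ : W.c1Norm φ < ⊤) :
    ∃ C : ℝ, ∀ t ∈ Ioo (-W.r) W.r, ‖φ (W.param t)‖ ≤ C := by
  refine ⟨(W.c1Norm φ).toReal, fun t ht => ?_⟩
  rw [← toReal_enorm]
  exact ENNReal.toReal_mono hφ.ne
    ((le_iSup₂ (f := fun t (_ : t ∈ Ioo (-W.r) W.r) => ‖φ (W.param t)‖ₑ) t ht).trans le_self_add)

theorem integrable [CompactSpace M]
    [IsContMDiffRiemannianBundle I ∞ Plane (fun x : M => TangentSpace I x)] (hκ : 0 < κ)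
    {h φ : M → ℂ} (hh : Continuous h) (hφ : φ ∈ W.c1Functions) :
    IntegrableOn (fun t => h (W.param t) * φ (W.param t) * (W.speed t : ℂ))
      (Ioo (-W.r) W.r) := by
  obtain ⟨C, hC⟩ := W.enorm_le_of_c1Norm_lt hφ.2
  obtain ⟨D, hD⟩ : ∃ D : ℝ, ∀ x, ‖h x‖ ≤ D := by
    obtain ⟨D, hD⟩ := (isCompact_range hh).isBounded.exists_norm_le
    exact ⟨D, fun x => hD _ (mem_range_self x)⟩
  have hc : ContinuousOn (fun t => h (W.param t) * φ (W.param t) * (W.speed t : ℂ))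
      (Ioo (-W.r) W.r) :=
    ((hh.comp_continuousOn W.param_contMDiffOn.continuousOn).mul hφ.1.continuousOn).mul
      (Complex.continuous_ofReal.comp_continuousOn W.speed_continuousOn)
  refine ⟨hc.aestronglyMeasurable measurableSet_Ioo,
    .restrict_of_bounded (C := D * C * ((1 + κ) * (1 + κ))) (by simp) ?_⟩
  refine (ae_restrict_iff' measurableSet_Ioo).2 (Filter.Eventually.of_forall fun t ht => ?_)
  have h1 := hD (W.param t)
  have h2 := hC t ht
  have h3 := W.speed_le_const hκ ht
  have h4 : ‖(W.speed t : ℂ)‖ = W.speed t := by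
    rw [Complex.norm_real]
    exact Real.norm_of_nonneg (norm_nonneg _)
  have h5 : 0 ≤ W.speed t := norm_nonneg _
  have h6 := (norm_nonneg _).trans h1
  have h7 := (norm_nonneg _).trans h2
  rw [norm_mul, norm_mul, h4]
  gcongr

end Integrability

end AdmissibleLeaf

/-! ### The norms and the spaces -/

variable (I M) in
/-- The space `C¹(M, ℂ)`. -/
def C1Space : Submodule ℂ (M → ℂ) where
  carrier := {h | ContMDiff I 𝓘(ℝ, ℂ) 1 h}
  add_mem' hf hg := ContMDiff.add hf hg
  zero_mem' := contMDiff_const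
  smul_mem' c f hf := by
    have : ContMDiff 𝓘(ℝ, ℂ) 𝓘(ℝ, ℂ) 1 (fun z : ℂ => c * z) := by
      rw [contMDiff_iff_contDiff]
      fun_prop
    exact this.comp hf

section Norms

variable {T : PiecewiseHyperbolicMap I M} {κ : ℝ} (A : LeafCharts T κ) (r₀ B α β q ε₀ b : ℝ)

/-- The weak norm. -/
def weakNorm (h : C1Space I M) : ℝ≥0∞ :=
  ⨆ (W : AdmissibleLeaf A r₀ B) (φ : W.c1Functions) (_ : W.c1Norm φ ≤ 1), ‖W.integral h φ‖ₑ

/-- The strong stable norm. -/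
def strongStableNorm (h : C1Space I M) : ℝ≥0∞ :=
  ⨆ (W : AdmissibleLeaf A r₀ B) (φ : W.c1Functions) (_ : W.length ^ α * W.holderNorm q φ ≤ 1),
    ‖W.integral h φ‖ₑ

/-- The strong unstable norm. -/
def strongUnstableNorm (h : C1Space I M) : ℝ≥0∞ :=
  ⨆ (ε : ℝ) (_ : ε ∈ Ioc 0 ε₀) (W₁ : AdmissibleLeaf A r₀ B) (W₂ : AdmissibleLeaf A r₀ B)
    (_ : W₁.leafDist W₂ ≤ ENNReal.ofReal ε)
    (φ₁ : W₁.c1Functions) (φ₂ : W₂.c1Functions) (_ : W₁.c1Norm φ₁ ≤ 1) (_ : W₂.c1Norm φ₂ ≤ 1)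
    (_ : W₁.testDist W₂ q φ₁ φ₂ ≤ ENNReal.ofReal ε),
    (ENNReal.ofReal ε ^ β)⁻¹ * ‖W₁.integral h φ₁ - W₂.integral h φ₂‖ₑ

/-- The strong norm. -/
def strongNorm (h : C1Space I M) : ℝ≥0∞ :=
  strongStableNorm A r₀ B α q h + ENNReal.ofReal b * strongUnstableNorm A r₀ B β q ε₀ h

section ExtSeminorms

variable [CompactSpace M]
  [IsContMDiffRiemannianBundle I ∞ Plane (fun x : M => TangentSpace I x)]

/-- `h ↦ ∫_W h φ dm` as a linear functional. -/
def leafFunctional (hκ : 0 < κ) {A : LeafCharts T κ} {r₀ B : ℝ} (W : AdmissibleLeaf A r₀ B)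
    (φ : W.c1Functions) : C1Space I M →ₗ[ℂ] ℂ where
  toFun h := W.integral h φ
  map_add' f g := by
    have := integral_add (W.integrable hκ f.2.continuous φ.2) (W.integrable hκ g.2.continuous φ.2)
    simp only [AdmissibleLeaf.integral]
    rw [← this]
    congr 1
    ext t
    simp [add_mul]
  map_smul' c f := by
    simp only [AdmissibleLeaf.integral, RingHom.id_apply, smul_eq_mul]
    rw [← integral_const_mul]
    congr 1
    ext t
    simp [mul_assoc]

theorem isExtSeminorm_weakNorm (hκ : 0 < κ) : IsExtSeminorm (weakNorm A r₀ B) :=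
  .iSup fun W => .iSup fun φ => .iSup fun _ => .of_linear (leafFunctional hκ W φ)

theorem isExtSeminorm_strongNorm (hκ : 0 < κ) :
    IsExtSeminorm (strongNorm A r₀ B α β q ε₀ b) :=
  .add (.iSup fun W => .iSup fun φ => .iSup fun _ => .of_linear (leafFunctional hκ W φ)) <|
    .const_mul (.iSup fun _ => .iSup fun _ => .iSup fun W₁ => .iSup fun W₂ => .iSup fun _ =>
      .iSup fun φ₁ => .iSup fun φ₂ => .iSup fun _ => .iSup fun _ => .iSup fun _ =>
        .const_mul (.of_linear (leafFunctional hκ W₁ φ₁ - leafFunctional hκ W₂ φ₂)) _) _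

/-- The strong space `𝓑`: the completion of `C¹(M, ℂ)` in the strong norm. -/
abbrev LeafStrongSpace (hκ : 0 < κ) : Type _ :=
  (isExtSeminorm_strongNorm A r₀ B α β q ε₀ b hκ).Completed

/-- The weak space `𝓑_w`: the completion of `C¹(M, ℂ)` in the weak norm. -/
abbrev LeafWeakSpace (hκ : 0 < κ) : Type _ := (isExtSeminorm_weakNorm A r₀ B hκ).Completed

end ExtSeminorms

end Norms

end Setting

end

/-! Three estimates carry the proof. First, a test function in the unit ball of `C¹(W)` has Hölder
norm at most 3 and leaves have bounded length, so the weak norm is at most a constant times the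
strong one, and the identity extends to the completions. Injectivity is not automatic for such an
extension. It holds because both parts of the strong norm are suprema of functionals tested against
`C¹` functions only, and each of these functionals is weakly continuous. The strong norm is
therefore weakly lower semicontinuous up to a factor (`strongNorm_le_of_tendsto`), so a strongly
Cauchy sequence that tends weakly to 0 tends strongly to 0. For compactness, the pairs (leaf, test
function) are totally bounded: by Arzelà–Ascoli, `C²` bounds give precompactness of the graphs in
`C¹`, and `C¹` bounds that of the test functions in `C^q`, as `q < 1` (`exists_finite_net`). The
unstable norm compares the integrals of close pairs, so finitely many functionals determine the weak
norm up to a small multiple of the strong norm (`exists_finset_weakNorm_le`). Bounded sets in finite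
dimension are totally bounded, and the conclusion passes to the completion by density. -/

noncomputable section

/-! ### Completions of extended seminorms: criteria for injectivity and compactness. -/

namespace IsExtSeminorm

variable {V : Type*} [AddCommGroup V] [Module ℂ V] {N N' : V → ℝ≥0∞}

theorem lt_top (hN : IsExtSeminorm N) (x : hN.FinitePart) : N (hN.val x) < ⊤ := Subtype.prop x

theorem val_sub (hN : IsExtSeminorm N) (x y : hN.FinitePart) :
    hN.val (x - y) = hN.val x - hN.val y := rfl

theorem enorm_eq (hN : IsExtSeminorm N) (x : hN.FinitePart) : ‖x‖ₑ = N (hN.val x) := by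
  rw [← ofReal_norm, hN.norm_eq, ENNReal.ofReal_toReal (hN.lt_top x).ne]

/-- If `N'` is dominated by `N`, the vectors of finite norm for `N` are mapped continuously to
those for `N'`. -/
def inclusion (hN : IsExtSeminorm N) (hN' : IsExtSeminorm N') {C : ℝ≥0∞} (hC : C ≠ ⊤)
    (h : ∀ x, N' x ≤ C * N x) : hN.FinitePart →L[ℂ] hN'.FinitePart :=
  LinearMap.mkContinuous
    { toFun := fun x => hN'.toFinitePart (hN.val x)
        ((h _).trans_lt (ENNReal.mul_lt_top hC.lt_top (hN.lt_top x)))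
      map_add' := fun _ _ => rfl
      map_smul' := fun _ _ => rfl } C.toReal (fun x => by
        rw [hN.norm_eq, hN'.norm_eq, ← ENNReal.toReal_mul]
        exact ENNReal.toReal_mono (ENNReal.mul_ne_top hC (hN.lt_top x).ne) (h _))

theorem val_inclusion (hN : IsExtSeminorm N) (hN' : IsExtSeminorm N') {C : ℝ≥0∞} (hC : C ≠ ⊤)
    (h : ∀ x, N' x ≤ C * N x) (x : hN.FinitePart) :
    hN'.val (inclusion hN hN' hC h x) = hN.val x := rfl

/-- The completed inclusion is injective as soon as `N` is lower semicontinuous (up to a constant)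
with respect to `N'`. -/
theorem injective_completion_inclusion (hN : IsExtSeminorm N) (hN' : IsExtSeminorm N')
    {C D : ℝ≥0∞} (hC : C ≠ ⊤) (h : ∀ x, N' x ≤ C * N x) (hD : D ≠ ⊤)
    (hlsc : ∀ (x : ℕ → V) (y : V) (c : ℝ≥0∞), Filter.Tendsto (fun n => N' (x n - y)) .atTop (𝓝 0) →
      (∀ᶠ n in .atTop, N (x n) ≤ c) → N y ≤ D * c) :
    Function.Injective (inclusion hN hN' hC h).completion := by
  rw [injective_iff_map_eq_zero]
  intro z hz
  obtain ⟨x, hx⟩ : ∃ x : ℕ → hN.FinitePart,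
      Filter.Tendsto (fun n => (x n : hN.Completed)) .atTop (𝓝 z) := by
    obtain ⟨u, hu, hu'⟩ := mem_closure_iff_seq_limit.1
      (UniformSpace.Completion.denseRange_coe (α := hN.FinitePart) z)
    choose x hx using hu
    exact ⟨x, by simpa only [hx] using hu'⟩
  have hweak : Filter.Tendsto (fun n => N' (hN.val (x n))) .atTop (𝓝 0) := by
    have h1 := (((inclusion hN hN' hC h).completion).continuous.tendsto z).comp hx
    rw [hz] at h1
    have h2 := h1.enorm
    simp only [Function.comp_def, ContinuousLinearMap.completion_apply_coe, enorm_zero] at h2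
    refine h2.congr fun n => ?_
    rw [← val_inclusion hN hN' hC h, ← hN'.enorm_eq, ← ofReal_norm, ← ofReal_norm,
      UniformSpace.Completion.norm_coe]
  -- By uniqueness of limits, `z = 0` once the approximating vectors tend to 0 in the strong norm.
  refine tendsto_nhds_unique hx ?_
  have hcauchy : CauchySeq x := by
    have h1 := hx.cauchySeq
    rw [Metric.cauchySeq_iff] at h1 ⊢
    simpa only [UniformSpace.Completion.dist_eq] using h1
  rw [tendsto_zero_iff_norm_tendsto_zero]
  simp only [UniformSpace.Completion.norm_coe]
  rw [Metric.tendsto_atTop]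
  intro ε hε
  rw [Metric.cauchySeq_iff] at hcauchy
  obtain ⟨n₀, hn₀⟩ := hcauchy (ε / 2 / (D.toReal + 1)) (by positivity)
  refine ⟨n₀, fun n hn => ?_⟩
  -- For fixed `n`, the differences `x n - x m` converge weakly to `x n` as `m → ∞`, while the
  -- Cauchy property bounds their strong norms. Lower semicontinuity transfers this bound to `x n`.
  have h1 : N (hN.val (x n)) ≤ D * ENNReal.ofReal (ε / 2 / (D.toReal + 1)) := by
    refine hlsc (fun m => hN.val (x n) - hN.val (x m)) _ _ ?_ ?_
    · refine hweak.congr fun m => ?_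
      rw [sub_sub_cancel_left, hN'.neg]
    · filter_upwards [Filter.eventually_ge_atTop n₀] with m hm
      rw [← val_sub, ← hN.enorm_eq, ← ofReal_norm]
      refine ENNReal.ofReal_le_ofReal ?_
      rw [← dist_eq_norm]
      exact (hn₀ n hn m hm).le
  rw [Real.dist_0_eq_abs, abs_norm, hN.norm_eq]
  have h2 := ENNReal.toReal_mono (ENNReal.mul_ne_top hD ENNReal.ofReal_ne_top) h1
  rw [ENNReal.toReal_mul, ENNReal.toReal_ofReal (by positivity)] at h2
  refine h2.trans_lt ?_
  have h3 : 0 ≤ D.toReal := ENNReal.toReal_nonneg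
  rw [div_div, mul_div_assoc', div_lt_iff₀ (by positivity)]
  nlinarith

/-- The completed inclusion is compact if, up to a small multiple of `N`, the norm `N'` is
controlled by finitely many functionals. -/
theorem isCompact_closure_completion_inclusion (hN : IsExtSeminorm N) (hN' : IsExtSeminorm N')
    {C : ℝ≥0∞} (hC : C ≠ ⊤) (h : ∀ x, N' x ≤ C * N x)
    (hfin : ∀ ε : ℝ, 0 < ε → ∃ s : Finset (V →ₗ[ℂ] ℂ), (∀ l ∈ s, ∀ x, ‖l x‖ₑ ≤ N' x) ∧
      ∀ x, N' x ≤ (⨆ l ∈ s, ‖l x‖ₑ) + ENNReal.ofReal ε * N x) :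
    IsCompact (closure ((inclusion hN hN' hC h).completion '' Metric.closedBall 0 1)) := by
  set f := inclusion hN hN' hC h
  -- An open ball of radius larger than 1 is used so that, in the completion, its dense part
  -- approximates every point of the closed unit ball.
  have htb : TotallyBounded (f '' Metric.ball 0 2) := by
    refine Metric.totallyBounded_iff.2 fun ε hε => ?_
    obtain ⟨s, hs, hs'⟩ := hfin (ε / 6) (by positivity)
    -- The finitely many functionals map the ball to a bounded set of a finite-dimensional space,
    -- where a finite net exists.
    let L : hN.FinitePart → (s → ℂ) := fun x l => l.1 (hN.val x)
    have hL : TotallyBounded (L '' Metric.ball 0 2) := by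
      suffices h0 : Bornology.IsBounded (L '' Metric.ball 0 2) from
        h0.isCompact_closure.totallyBounded.subset subset_closure
      refine isBounded_iff_forall_norm_le.2 ⟨C.toReal * 2, ?_⟩
      rintro _ ⟨x, hx, rfl⟩
      refine (pi_norm_le_iff_of_nonneg (by positivity)).2 fun l => ?_
      have h1 := (hs l.1 l.2 (hN.val x)).trans (h _)
      have h2 := ENNReal.toReal_mono (ENNReal.mul_ne_top hC (hN.lt_top x).ne) h1
      rw [toReal_enorm, ENNReal.toReal_mul, ← hN.norm_eq] at h2
      refine h2.trans (mul_le_mul_of_nonneg_left ?_ ENNReal.toReal_nonneg)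
      rw [mem_ball_zero_iff] at hx
      exact hx.le
    obtain ⟨t, ht, htf, hcov⟩ := Metric.finite_approx_of_totallyBounded hL (ε / 6) (by positivity)
    choose! g hg hgL using fun y (hy : y ∈ t) => ht hy
    refine ⟨(fun y => f (g y)) '' t, htf.image _, ?_⟩
    rintro _ ⟨x, hx, rfl⟩
    obtain ⟨y, hy, hxy⟩ := mem_iUnion₂.1 (hcov (mem_image_of_mem L hx))
    refine mem_iUnion₂.2 ⟨f (g y), mem_image_of_mem _ hy, ?_⟩
    rw [Metric.mem_ball, dist_eq_norm, ← map_sub]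
    -- The functionals contribute `ε / 6`. The strong norm of `x - g y` is at most 4, both vectors
    -- lying in the ball of radius 2, so the total is `5ε / 6 < ε`.
    have h3 : ‖f (x - g y)‖ₑ ≤ ENNReal.ofReal (ε / 6 + ε / 6 * 4) := by
      rw [ENNReal.ofReal_add (by positivity) (by positivity),
        ENNReal.ofReal_mul (by positivity), enorm_eq, val_inclusion]
      refine (hs' _).trans (add_le_add (iSup₂_le fun l hl => ?_) ?_)
      · rw [val_sub, map_sub, ← ofReal_norm, ← dist_eq_norm]
        refine ENNReal.ofReal_le_ofReal ?_
        rw [← hgL y hy] at hxy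
        exact ((dist_le_pi_dist (L x) (L (g y)) ⟨l, hl⟩).trans hxy.le)
      · gcongr
        rw [← hN.enorm_eq, ← ofReal_norm]
        refine ENNReal.ofReal_le_ofReal ((norm_sub_le _ _).trans ?_)
        have h4 := hg y hy
        rw [mem_ball_zero_iff] at hx h4
        linarith
    rw [← ofReal_norm, ENNReal.ofReal_le_ofReal_iff (by positivity)] at h3
    linarith
  have htb' : TotallyBounded
      (((↑) : hN'.FinitePart → hN'.Completed) '' (f '' Metric.ball 0 2)) :=
    htb.image (UniformSpace.Completion.uniformContinuous_coe _)
  refine TotallyBounded.isCompact_of_isClosed (TotallyBounded.closure ?_) isClosed_closure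
  refine (TotallyBounded.closure htb').subset ?_
  rintro _ ⟨z, hz, rfl⟩
  have hz' : z ∈ closure (((↑) : hN.FinitePart → hN.Completed) '' Metric.ball 0 2) := by
    have h1 : z ∈ Metric.ball (0 : hN.Completed) 2 :=
      Metric.closedBall_subset_ball (by norm_num) hz
    have h2 := UniformSpace.Completion.denseRange_coe (α := hN.FinitePart)
    refine closure_mono ?_ (h2.open_subset_closure_inter Metric.isOpen_ball h1)
    rintro _ ⟨h3, x, rfl⟩
    refine ⟨x, ?_, rfl⟩
    rw [mem_ball_zero_iff] at h3 ⊢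
    rwa [UniformSpace.Completion.norm_coe] at h3
  have h5 := image_closure_subset_closure_image f.completion.continuous
    (mem_image_of_mem f.completion hz')
  refine closure_mono ?_ h5
  rintro _ ⟨_, ⟨x, hx, rfl⟩, rfl⟩
  rw [ContinuousLinearMap.completion_apply_coe]
  exact mem_image_of_mem _ (mem_image_of_mem _ hx)

end IsExtSeminorm

end

noncomputable section

/-! ### Functions on symmetric intervals: compactness and interpolation. -/

section Interval

/-- A uniformly Lipschitz and bounded family of functions on symmetric intervals extends to a
relatively compact family of continuous functions on a fixed interval. -/
theorem exists_isCompact_lipschitz_extension {P E : Type*} [NormedAddCommGroup E] [NormedSpace ℝ E]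
    [FiniteDimensional ℝ E] (r₀ : ℝ) (K : NNReal) (C : ℝ) (r : P → ℝ) (hr : ∀ p, 0 < r p)
    (f : P → ℝ → E) (hf : ∀ p, LipschitzOnWith K (f p) (Ioo (-r p) (r p)))
    (hC : ∀ p, ‖f p 0‖ ≤ C) :
    ∃ (Φ : P → BoundedContinuousFunction (Icc (-r₀) r₀) E)
      (S : Set (BoundedContinuousFunction (Icc (-r₀) r₀) E)), IsCompact S ∧ (∀ p, Φ p ∈ S) ∧
      ∀ p t (ht : t ∈ Icc (-r₀) r₀), t ∈ Ioo (-r p) (r p) → Φ p ⟨t, ht⟩ = f p t := by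
  have : ProperSpace E := FiniteDimensional.proper_real E
  -- Extension to all of `ℝ` multiplies the Lipschitz constant by a factor depending only on `E`.
  -- Functions with different domains can then be compared on one compact interval, where
  -- Arzelà–Ascoli applies.
  choose g hg hfg using fun p => (hf p).extend_finite_dimension
  set K' := lipschitzExtensionConstant E * K
  let Φ : P → BoundedContinuousFunction (Icc (-r₀) r₀) E := fun p =>
    .mkOfCompact ⟨fun t => g p t, (hg p).continuous.comp continuous_subtype_val⟩
  have hΦ : ∀ p t, Φ p t = g p t := fun _ _ => rfl
  refine ⟨Φ, closure (range Φ), BoundedContinuousFunction.arzela_ascoli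
    (Metric.closedBall (0 : E) (C + K' * r₀)) (isCompact_closedBall _ _) _ ?_ ?_,
    fun p => subset_closure (mem_range_self p), fun p t ht ht' => (hfg p ht').symm⟩
  · rintro _ t ⟨p, rfl⟩
    rw [mem_closedBall_zero_iff, hΦ]
    have h0 : ‖g p 0‖ ≤ C := by
      rw [← hfg p ⟨neg_lt_zero.2 (hr p), hr p⟩]
      exact hC p
    have h1 := (hg p).dist_le_mul t 0
    rw [dist_eq_norm, dist_zero_right, Real.norm_eq_abs] at h1
    have h2 : |(t : ℝ)| ≤ r₀ := abs_le.2 t.2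
    have h3 := norm_add_le (g p t - g p 0) (g p 0)
    rw [sub_add_cancel] at h3
    have h4 : (K' : ℝ) * |(t : ℝ)| ≤ K' * r₀ := mul_le_mul_of_nonneg_left h2 K'.2
    linarith
  · refine (LipschitzWith.uniformEquicontinuous _ K' ?_).equicontinuous
    rintro ⟨_, p, rfl⟩
    exact fun x y => hg p x y

/-- Interpolation between the supremum norm and the Lipschitz seminorm. -/
theorem div_rpow_le_of_le_mul {a d m L : ℝ≥0∞} {q : ℝ} (hq : 0 ≤ q) (hq1 : q ≤ 1) (hm : a ≤ m)
    (hL : a ≤ L * d) : a / d ^ q ≤ m ^ (1 - q) * L ^ q := by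
  refine ENNReal.div_le_of_le_mul ?_
  calc a = a ^ (1 - q) * a ^ q := by
        rw [← ENNReal.rpow_add_of_nonneg _ _ (by linarith) hq]
        simp
    _ ≤ m ^ (1 - q) * (L * d) ^ q := by gcongr
    _ = _ := by rw [ENNReal.mul_rpow_of_nonneg _ _ hq, mul_assoc]

/-- The increments are at most `2 * m` and at most `L * d s t`; interpolation gives the Hölder
quotient. For `q < 1` and finite `L`, the bound tends to 0 with `m`, so uniform closeness yields
`C^q` closeness. -/
theorem intervalHolderNorm_le {r q : ℝ} (hq : 0 ≤ q) (hq1 : q ≤ 1) {d : ℝ → ℝ → ℝ≥0∞} {f : ℝ → ℂ}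
    {m L : ℝ≥0∞} (hm : ∀ t ∈ Ioo (-r) r, ‖f t‖ₑ ≤ m)
    (hL : ∀ s ∈ Ioo (-r) r, ∀ t ∈ Ioo (-r) r, ‖f s - f t‖ₑ ≤ L * d s t) :
    intervalHolderNorm r q d f ≤ m + (2 * m) ^ (1 - q) * L ^ q := by
  refine add_le_add (iSup₂_le hm) (iSup₂_le fun s hs => iSup₂_le fun t ht => iSup_le fun _ =>
    div_rpow_le_of_le_mul hq hq1 ?_ (hL s hs t ht))
  rw [two_mul]
  exact enorm_sub_le.trans (add_le_add (hm s hs) (hm t ht))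

/-- By the mean value inequality from the common value at 0, closeness of the derivatives suffices.
-/
theorem intervalC1Norm_sub_le {r δ : ℝ} {f g : ℝ → ℝ}
    (hf : DifferentiableOn ℝ f (Ioo (-r) r)) (hg : DifferentiableOn ℝ g (Ioo (-r) r))
    (hfg : f 0 = g 0) (h : ∀ t ∈ Ioo (-r) r, ‖deriv f t - deriv g t‖ ≤ δ) :
    intervalC1Norm r (fun t => f t - g t) ≤ ENNReal.ofReal (δ * r) + ENNReal.ofReal δ := by
  have hd : ∀ t ∈ Ioo (-r) r, HasDerivAt (fun t => f t - g t) (deriv f t - deriv g t) t :=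
    fun t ht => ((hf.differentiableAt (isOpen_Ioo.mem_nhds ht)).hasDerivAt).sub
      ((hg.differentiableAt (isOpen_Ioo.mem_nhds ht)).hasDerivAt)
  refine add_le_add (iSup₂_le fun t ht => ?_) (iSup₂_le fun t ht => ?_)
  · have hr : 0 < r := by linarith [ht.1, ht.2]
    have h0 : (0 : ℝ) ∈ Ioo (-r) r := ⟨by linarith, hr⟩
    have h1 := (convex_Ioo (-r) r).norm_image_sub_le_of_norm_hasDerivWithin_le
      (fun s hs => (hd s hs).hasDerivWithinAt) h h0 ht
    simp only [hfg, sub_self, sub_zero] at h1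
    rw [← ofReal_norm]
    refine ENNReal.ofReal_le_ofReal (h1.trans ?_)
    have h2 : 0 ≤ δ := (norm_nonneg _).trans (h t ht)
    exact mul_le_mul_of_nonneg_left (abs_le.2 ⟨ht.1.le, ht.2.le⟩) h2
  · rw [(hd t ht).deriv, ← ofReal_norm]
    exact ENNReal.ofReal_le_ofReal (h t ht)

end Interval

section Setting

variable {H : Type*} [TopologicalSpace H] {I : ModelWithCorners ℝ Plane H}
  {M : Type*} [TopologicalSpace M] [ChartedSpace H M] [IsManifold I ∞ M]
  [RiemannianBundle (fun x : M => TangentSpace I x)]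
  {T : PiecewiseHyperbolicMap I M} {κ : ℝ} {A : LeafCharts T κ} {r₀ B : ℝ}

/-! ### Uniform bounds for leaves and their test functions. -/

namespace AdmissibleLeaf

variable (W W₁ W₂ : AdmissibleLeaf A r₀ B)

theorem differentiableOn_F : DifferentiableOn ℝ W.F (Ioo (-W.r) W.r) :=
  (W.contDiffOn.mono Ioo_subset_Icc_self).differentiableOn (by norm_num)

/-- The `C²` bound makes the derivatives equicontinuous, which gives compactness of the graphs in
the `C¹` topology. -/
theorem lipschitzOnWith_deriv_F :
    LipschitzOnWith B.toNNReal (deriv W.F) (Ioo (-W.r) W.r) := by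
  refine (convex_Ioo _ _).lipschitzOnWith_of_nnnorm_deriv_le (𝕜 := ℝ) (fun t ht => ?_)
    (fun t ht => ?_)
  · exact (((W.contDiffOn.mono Ioo_subset_Icc_self).deriv_of_isOpen (m := 1) isOpen_Ioo
      (by norm_num)).differentiableOn (by norm_num)).differentiableAt (isOpen_Ioo.mem_nhds ht)
  · have h : ‖deriv (deriv W.F) t‖ₑ ≤ ENNReal.ofReal B :=
      ((le_iSup₂ (f := fun t (_ : t ∈ Ioo (-W.r) W.r) => ‖deriv (deriv W.F) t‖ₑ) t ht).trans
        le_add_self).trans W.F_C2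
    exact ENNReal.coe_le_coe.1 h

theorem zero_mem_Ioo : (0 : ℝ) ∈ Ioo (-W.r) W.r := ⟨neg_lt_zero.2 W.r_pos, W.r_pos⟩

theorem norm_x_le : ‖W.x‖ ≤ 2 * ∑ j, A.radius j := by
  have h : ∀ k, |W.x k| ≤ ∑ j, A.radius j := fun k => by
    have h1 := A.radius_pos W.j
    have h2 := Finset.single_le_sum (fun j _ => (A.radius_pos j).le) (Finset.mem_univ W.j)
    have h3 : |W.x k| < A.radius W.j / 2 := W.x_mem.2 k
    linarith
  have h0 := (abs_nonneg _).trans (h 0)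
  rw [EuclideanSpace.norm_eq]
  refine Real.sqrt_le_iff.2 ⟨by positivity, ?_⟩
  simp only [Fin.sum_univ_two, Real.norm_eq_abs]
  have h1 := pow_le_pow_left₀ (abs_nonneg _) (h 0) 2
  have h2 := pow_le_pow_left₀ (abs_nonneg _) (h 1) 2
  nlinarith


theorem enorm_le_c1Norm (φ : M → ℂ) {t : ℝ} (ht : t ∈ Ioo (-W.r) W.r) :
    ‖φ (W.param t)‖ₑ ≤ W.c1Norm φ :=
  (le_iSup₂ (f := fun t (_ : t ∈ Ioo (-W.r) W.r) => ‖φ (W.param t)‖ₑ) t ht).trans le_self_add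

theorem enorm_deriv_le {φ : M → ℂ} (hφ : W.c1Norm φ ≤ 1) {t : ℝ} (ht : t ∈ Ioo (-W.r) W.r) :
    ‖deriv (φ ∘ W.param) t‖ₑ ≤ ENNReal.ofReal (W.speed t) := by
  have h : ‖deriv (φ ∘ W.param) t‖ₑ / ENNReal.ofReal (W.speed t) ≤ 1 :=
    ((le_iSup₂ (f := fun t (_ : t ∈ Ioo (-W.r) W.r) =>
      ‖deriv (φ ∘ W.param) t‖ₑ / ENNReal.ofReal (W.speed t)) t ht).trans le_add_self).trans hφ
  -- No lower bound on the speed is needed: in `ℝ≥0∞` a nonzero number divided by 0 is `∞`, so the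
  -- bound forces the derivative to vanish where the speed does.
  rw [ENNReal.div_le_iff_le_mul (.inr ENNReal.one_ne_top) (.inl ENNReal.ofReal_ne_top),
    one_mul] at h
  exact h

theorem lipschitzOnWith_comp_param (hκ : 0 < κ) {φ : M → ℂ} (hφ : φ ∈ W.c1Functions)
    (hφ1 : W.c1Norm φ ≤ 1) :
    LipschitzOnWith ((1 + κ) * (1 + κ)).toNNReal (φ ∘ W.param) (Ioo (-W.r) W.r) := by
  refine (convex_Ioo _ _).lipschitzOnWith_of_nnnorm_deriv_le (𝕜 := ℝ) (fun t ht => ?_)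
    (fun t ht => ?_)
  · exact (hφ.1.differentiableOn (by norm_num)).differentiableAt (isOpen_Ioo.mem_nhds ht)
  · exact ENNReal.coe_le_coe.1 ((W.enorm_deriv_le hφ1 ht).trans
      (ENNReal.ofReal_le_ofReal (W.speed_le_const hκ ht)))

/-- The derivative in the parameter is bounded by the speed, whose integral is the distance along
the leaf. -/
theorem enorm_sub_le_arcDist {φ : M → ℂ} (hφ : φ ∈ W.c1Functions) (hφ1 : W.c1Norm φ ≤ 1)
    {s t : ℝ} (hs : s ∈ Ioo (-W.r) W.r) (ht : t ∈ Ioo (-W.r) W.r) :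
    ‖φ (W.param s) - φ (W.param t)‖ₑ ≤ W.arcDist s t := by
  wlog hst : t ≤ s generalizing s t
  · rw [← edist_eq_enorm_sub, edist_comm, edist_eq_enorm_sub]
    refine (this ht hs (not_le.1 hst).le).trans_eq ?_
    rw [arcDist, arcDist, min_comm, max_comm]
  have hsub : Icc t s ⊆ Ioo (-W.r) W.r := fun u hu => ⟨ht.1.trans_le hu.1, hu.2.trans_lt hs.2⟩
  refine (enorm_sub_le_lintegral_deriv_of_contDiffOn_Icc (f := φ ∘ W.param) (hφ.1.mono hsub)
    hst).trans ?_
  rw [arcDist, min_eq_right hst, max_eq_left hst, pathELength_eq_lintegral_mfderiv_Icc]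
  refine setLIntegral_mono' measurableSet_Icc fun u hu => ?_
  refine (W.enorm_deriv_le hφ1 (hsub hu)).trans_eq ?_
  exact ofReal_norm _

theorem length_le (hκ : 0 < κ) : W.length ≤ ENNReal.ofReal ((1 + κ) * (1 + κ) * (2 * r₀)) := by
  rw [length, pathELength_eq_lintegral_mfderiv_Ioo]
  have h : ∀ t ∈ Ioo (-W.r) W.r, ‖mfderiv 𝓘(ℝ, ℝ) I W.param t (1 : ℝ)‖ₑ ≤
      ENNReal.ofReal ((1 + κ) * (1 + κ)) := fun t ht => by
    rw [← ofReal_norm]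
    exact ENNReal.ofReal_le_ofReal (W.speed_le_const hκ ht)
  refine (setLIntegral_mono' measurableSet_Ioo h).trans ?_
  rw [setLIntegral_const, Real.volume_Ioo, ← ENNReal.ofReal_mul (by positivity)]
  refine ENNReal.ofReal_le_ofReal (mul_le_mul_of_nonneg_left ?_ (by positivity))
  linarith [W.r_le]

/-- Interpolation with `m = L = 1` gives `1 + 2 ^ (1 - q) ≤ 3`. -/
theorem holderNorm_le {φ : M → ℂ} (hφ : φ ∈ W.c1Functions) (hφ1 : W.c1Norm φ ≤ 1) {q : ℝ}
    (hq : 0 ≤ q) (hq1 : q ≤ 1) : W.holderNorm q φ ≤ 3 := by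
  refine (intervalHolderNorm_le hq hq1 (fun t ht => (W.enorm_le_c1Norm φ ht).trans hφ1)
    (fun s hs t ht => (W.enorm_sub_le_arcDist hφ hφ1 hs ht).trans_eq (one_mul _).symm)).trans ?_
  rw [ENNReal.one_rpow, mul_one, mul_one]
  have h : (2 : ℝ≥0∞) ^ (1 - q) ≤ 2 ^ (1 : ℝ) :=
    ENNReal.rpow_le_rpow_of_exponent_le (by norm_num) (by linarith)
  rw [ENNReal.rpow_one] at h
  refine (add_le_add_right h 1).trans_eq (by norm_num)

theorem c1Norm_const_smul (c : ℂ) (φ : M → ℂ) : W.c1Norm (c • φ) = ‖c‖ₑ * W.c1Norm φ := by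
  have h : ∀ t, deriv ((c • φ) ∘ W.param) t = c * deriv (φ ∘ W.param) t := fun t =>
    deriv_const_mul_field (v := φ ∘ W.param) c
  simp only [c1Norm, h, Pi.smul_apply, smul_eq_mul, enorm_mul, mul_add, ENNReal.mul_iSup,
    mul_div_assoc]

theorem const_smul_mem_c1Functions (c : ℂ) {φ : M → ℂ} (hφ : φ ∈ W.c1Functions) :
    c • φ ∈ W.c1Functions := by
  refine ⟨contDiffOn_const.mul hφ.1, ?_⟩
  rw [c1Norm_const_smul]
  exact ENNReal.mul_lt_top enorm_lt_top hφ.2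

theorem holderNorm_const_smul (q : ℝ) (c : ℂ) (φ : M → ℂ) :
    W.holderNorm q (c • φ) = ‖c‖ₑ * W.holderNorm q φ := by
  simp only [holderNorm, intervalHolderNorm, Function.comp_apply, Pi.smul_apply, smul_eq_mul,
    ← mul_sub, enorm_mul, mul_add, ENNReal.mul_iSup, mul_div_assoc]

theorem integral_const_smul (c : ℂ) (h φ : M → ℂ) :
    W.integral h (c • φ) = c * W.integral h φ := by
  rw [integral, integral, ← integral_const_mul]
  congr 1
  ext t
  simp only [Pi.smul_apply, smul_eq_mul]
  ring

end AdmissibleLeaf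

/-! ### Total boundedness of the set of leaves with test functions. -/

variable (A r₀ B) in
/-- The leaves, each with a test function in the unit ball of `C¹`. -/
abbrev LeafTest : Type _ :=
  (W : AdmissibleLeaf A r₀ B) × {φ : W.c1Functions // W.c1Norm φ ≤ 1}

namespace LeafTest

/-- The pairs of a leaf and a test function embed into a compact metric space, in such a way that the
leaf and the test function vary continuously. -/
theorem exists_compact_coding (hκ : 0 < κ) :
    ∃ (Φ : LeafTest A r₀ B → (ℝ × Plane × ℝ) × BoundedContinuousFunction (Icc (-r₀) r₀) ℝ ×
      BoundedContinuousFunction (Icc (-r₀) r₀) ℂ), TotallyBounded (range Φ) ∧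
      ∀ p p', dist (Φ p) (Φ p') < 1 → p.1.j = p'.1.j ∧ ‖p.1.x - p'.1.x‖ ≤ dist (Φ p) (Φ p') ∧
        ‖p.1.r - p'.1.r‖ ≤ dist (Φ p) (Φ p') ∧
        ∀ t ∈ Ioo (-(min p.1.r p'.1.r)) (min p.1.r p'.1.r),
          ‖deriv p.1.F t - deriv p'.1.F t‖ ≤ dist (Φ p) (Φ p') ∧
          ‖p.2.1.1 (p.1.param t) - p'.2.1.1 (p'.1.param t)‖ ≤ dist (Φ p) (Φ p') := by
  obtain ⟨Φ₁, S₁, hS₁, hΦS₁, hΦ₁⟩ := exists_isCompact_lipschitz_extension r₀ B.toNNReal κ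
    (fun p : LeafTest A r₀ B => p.1.r) (fun p => p.1.r_pos) (fun p => deriv p.1.F)
    (fun p => p.1.lipschitzOnWith_deriv_F) (fun p => p.1.norm_deriv_F_le hκ p.1.zero_mem_Ioo)
  obtain ⟨Φ₂, S₂, hS₂, hΦS₂, hΦ₂⟩ := exists_isCompact_lipschitz_extension r₀
    ((1 + κ) * (1 + κ)).toNNReal 1
    (fun p : LeafTest A r₀ B => p.1.r) (fun p => p.1.r_pos) (fun p => p.2.1.1 ∘ p.1.param)
    (fun p => p.1.lipschitzOnWith_comp_param hκ p.2.1.2 p.2.2) (fun p => by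
      have h := (p.1.enorm_le_c1Norm p.2.1.1 p.1.zero_mem_Ioo).trans p.2.2
      rw [← ofReal_norm] at h
      exact ENNReal.ofReal_le_one.1 h)
  -- The chart index is coded as a real number, so codes at distance less than 1 have the same
  -- chart. The graph is coded by the derivative of `F`, which determines `F` on the leaf's interval
  -- since `F 0 = 0`. The product carries the maximum distance, which dominates each component.
  refine ⟨fun p => ((((p.1.j : ℕ) : ℝ), p.1.x, p.1.r), Φ₁ p, Φ₂ p), ?_, fun p p' hpp => ?_⟩
  · refine TotallyBounded.subset ?_ (((isCompact_Icc (a := (0 : ℝ)) (b := A.num)).prod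
      ((isCompact_closedBall (0 : Plane) (2 * ∑ j, A.radius j)).prod
        (isCompact_Icc (a := (0 : ℝ)) (b := r₀)))).prod (hS₁.prod hS₂)).totallyBounded
    rintro _ ⟨p, rfl⟩
    refine ⟨⟨⟨Nat.cast_nonneg _, Nat.cast_le.2 p.1.j.2.le⟩, ?_, p.1.r_pos.le, p.1.r_le⟩,
      hΦS₁ p, hΦS₂ p⟩
    rw [mem_closedBall_zero_iff]
    exact p.1.norm_x_le
  · set x : (ℝ × Plane × ℝ) × BoundedContinuousFunction (Icc (-r₀) r₀) ℝ ×
      BoundedContinuousFunction (Icc (-r₀) r₀) ℂ := ((((p.1.j : ℕ) : ℝ), p.1.x, p.1.r), Φ₁ p, Φ₂ p)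
    set y : (ℝ × Plane × ℝ) × BoundedContinuousFunction (Icc (-r₀) r₀) ℝ ×
      BoundedContinuousFunction (Icc (-r₀) r₀) ℂ :=
      ((((p'.1.j : ℕ) : ℝ), p'.1.x, p'.1.r), Φ₁ p', Φ₂ p')
    have h1 : dist x.1 y.1 ≤ dist x y := le_max_left _ _
    have h2 : dist x.2 y.2 ≤ dist x y := le_max_right _ _
    have h3 : dist x.1.1 y.1.1 ≤ dist x.1 y.1 := le_max_left _ _
    have h4 : dist x.1.2 y.1.2 ≤ dist x.1 y.1 := le_max_right _ _
    refine ⟨?_, ?_, ?_, fun t ht => ⟨?_, ?_⟩⟩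
    · have h5 : |((p.1.j : ℕ) : ℝ) - ((p'.1.j : ℕ) : ℝ)| < 1 := (h3.trans h1).trans_lt hpp
      have h6 : |((p.1.j : ℕ) : ℤ) - ((p'.1.j : ℕ) : ℤ)| < 1 := by exact_mod_cast h5
      rw [Int.abs_lt_one_iff] at h6
      ext
      omega
    · rw [← dist_eq_norm]
      exact ((le_max_left _ _ : dist x.1.2.1 y.1.2.1 ≤ dist x.1.2 y.1.2).trans h4).trans h1
    · rw [← dist_eq_norm]
      exact ((le_max_right _ _ : dist x.1.2.2 y.1.2.2 ≤ dist x.1.2 y.1.2).trans h4).trans h1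
    all_goals
      have hm : min p.1.r p'.1.r ≤ p.1.r := min_le_left _ _
      have hm' : min p.1.r p'.1.r ≤ p'.1.r := min_le_right _ _
      have ht₀ : t ∈ Icc (-r₀) r₀ := ⟨by linarith [ht.1, p.1.r_le], by linarith [ht.2, p.1.r_le]⟩
      have htp : t ∈ Ioo (-p.1.r) p.1.r := ⟨by linarith [ht.1], by linarith [ht.2]⟩
      have htp' : t ∈ Ioo (-p'.1.r) p'.1.r := ⟨by linarith [ht.1], by linarith [ht.2]⟩
    · rw [← hΦ₁ p t ht₀ htp, ← hΦ₁ p' t ht₀ htp', ← dist_eq_norm]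
      exact (BoundedContinuousFunction.dist_coe_le_dist (f := x.2.1) (g := y.2.1) _).trans
        ((le_max_left _ _ : dist x.2.1 y.2.1 ≤ dist x.2 y.2).trans h2)
    · have h5 : ‖Φ₂ p ⟨t, ht₀⟩ - Φ₂ p' ⟨t, ht₀⟩‖ ≤ dist x y := by
        rw [← dist_eq_norm]
        exact (BoundedContinuousFunction.dist_coe_le_dist (f := x.2.2) (g := y.2.2) _).trans
          ((le_max_right _ _ : dist x.2.2 y.2.2 ≤ dist x.2 y.2).trans h2)
      rwa [hΦ₂ p t ht₀ htp, hΦ₂ p' t ht₀ htp'] at h5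

/-- The 2 accounts for centre and radius. In `r₀ + 1`, the term `r₀` comes from integrating the
difference of derivatives from 0, and the 1 from the derivatives themselves. -/
theorem leafDist_le {δ : ℝ} (W₁ W₂ : AdmissibleLeaf A r₀ B) (hj : W₁.j = W₂.j)
    (hx : ‖W₁.x - W₂.x‖ ≤ δ) (hr : ‖W₁.r - W₂.r‖ ≤ δ)
    (hF : ∀ t ∈ Ioo (-(min W₁.r W₂.r)) (min W₁.r W₂.r), ‖deriv W₁.F t - deriv W₂.F t‖ ≤ δ) :
    W₁.leafDist W₂ ≤ ENNReal.ofReal δ *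
      (2 + ENNReal.ofReal (2⁻¹ * B⁻¹) * (ENNReal.ofReal r₀ + 1)) := by
  have hδ : 0 ≤ δ := (norm_nonneg _).trans hx
  have hm : min W₁.r W₂.r ≤ W₁.r := min_le_left _ _
  have hm' : min W₁.r W₂.r ≤ W₂.r := min_le_right _ _
  have h := intervalC1Norm_sub_le
    (W₁.differentiableOn_F.mono (Ioo_subset_Ioo (neg_le_neg hm) hm))
    (W₂.differentiableOn_F.mono (Ioo_subset_Ioo (neg_le_neg hm') hm'))
    (W₁.F_zero.trans W₂.F_zero.symm) hF
  have h' : ENNReal.ofReal (δ * min W₁.r W₂.r) ≤ ENNReal.ofReal δ * ENNReal.ofReal r₀ := by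
    rw [← ENNReal.ofReal_mul hδ]
    exact ENNReal.ofReal_le_ofReal (mul_le_mul_of_nonneg_left (hm.trans W₁.r_le) hδ)
  rw [AdmissibleLeaf.leafDist, if_pos hj, zero_add, ← ofReal_norm, ← ofReal_norm]
  calc _ ≤ ENNReal.ofReal δ + ENNReal.ofReal δ + ENNReal.ofReal (2⁻¹ * B⁻¹) *
        (ENNReal.ofReal δ * ENNReal.ofReal r₀ + ENNReal.ofReal δ) := by
        gcongr
        exact h.trans (add_le_add_left h' _)
    _ = _ := by ring

/-- Each test function is `(1 + κ)²`-Lipschitz in the parameter, so the difference has twice that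
constant; interpolation with the uniform bound `δ` gives the estimate. -/
theorem testDist_le (hκ : 0 < κ) {q δ : ℝ} (hq : 0 ≤ q) (hq1 : q ≤ 1) (p p' : LeafTest A r₀ B)
    (h : ∀ t ∈ Ioo (-(min p.1.r p'.1.r)) (min p.1.r p'.1.r),
      ‖p.2.1.1 (p.1.param t) - p'.2.1.1 (p'.1.param t)‖ ≤ δ) :
    p.1.testDist p'.1 q p.2.1 p'.2.1 ≤ ENNReal.ofReal δ + (2 * ENNReal.ofReal δ) ^ (1 - q) *
      (2 * ENNReal.ofReal ((1 + κ) * (1 + κ))) ^ q := by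
  have hm : min p.1.r p'.1.r ≤ p.1.r := min_le_left _ _
  have hm' : min p.1.r p'.1.r ≤ p'.1.r := min_le_right _ _
  refine intervalHolderNorm_le hq hq1 (fun t ht => ?_) (fun s hs t ht => ?_)
  · rw [← ofReal_norm]
    exact ENNReal.ofReal_le_ofReal (h t ht)
  · have h1 := p.1.lipschitzOnWith_comp_param hκ p.2.1.2 p.2.2
      (Ioo_subset_Ioo (neg_le_neg hm) hm hs) (Ioo_subset_Ioo (neg_le_neg hm) hm ht)
    have h2 := p'.1.lipschitzOnWith_comp_param hκ p'.2.1.2 p'.2.2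
      (Ioo_subset_Ioo (neg_le_neg hm') hm' hs) (Ioo_subset_Ioo (neg_le_neg hm') hm' ht)
    rw [edist_eq_enorm_sub] at h1 h2
    rw [sub_sub_sub_comm, two_mul, add_mul]
    exact enorm_sub_le.trans (add_le_add h1 h2)

/-- Finitely many pairs approximate all leaves and test functions. -/
theorem exists_finite_net (hκ : 0 < κ) {q : ℝ} (hq : 0 ≤ q) (hq1 : q < 1)
    {ε : ℝ} (hε : 0 < ε) : ∃ s : Finset (LeafTest A r₀ B), ∀ p : LeafTest A r₀ B, ∃ p' ∈ s,
      p.1.leafDist p'.1 ≤ ENNReal.ofReal ε ∧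
      p.1.testDist p'.1 q p.2.1 p'.2.1 ≤ ENNReal.ofReal ε := by
  obtain ⟨Φ, hΦ, hclose⟩ := exists_compact_coding (A := A) (r₀ := r₀) (B := B) hκ
  set L := ENNReal.ofReal ((1 + κ) * (1 + κ))
  obtain ⟨δ, hδ, hδ1, hδε, hδε'⟩ : ∃ δ : ℝ, 0 < δ ∧ δ < 1 ∧
      ENNReal.ofReal δ * (2 + ENNReal.ofReal (2⁻¹ * B⁻¹) * (ENNReal.ofReal r₀ + 1)) ≤
        ENNReal.ofReal ε ∧
      ENNReal.ofReal δ + (2 * ENNReal.ofReal δ) ^ (1 - q) * (2 * L) ^ q ≤ ENNReal.ofReal ε := by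
    have h0 : Filter.Tendsto ENNReal.ofReal (𝓝[>] 0) (𝓝 0) := by
      simpa using (ENNReal.continuous_ofReal.tendsto 0).mono_left nhdsWithin_le_nhds
    have hε' : (0 : ℝ≥0∞) < ENNReal.ofReal ε := ENNReal.ofReal_pos.2 hε
    have h1 : Filter.Tendsto (fun δ => ENNReal.ofReal δ *
        (2 + ENNReal.ofReal (2⁻¹ * B⁻¹) * (ENNReal.ofReal r₀ + 1))) (𝓝[>] 0) (𝓝 0) := by
      simpa using ENNReal.Tendsto.mul_const h0
        (b := 2 + ENNReal.ofReal (2⁻¹ * B⁻¹) * (ENNReal.ofReal r₀ + 1)) (.inr (ENNReal.add_ne_top.2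
          ⟨ENNReal.ofNat_ne_top, ENNReal.mul_ne_top ENNReal.ofReal_ne_top
            (ENNReal.add_ne_top.2 ⟨ENNReal.ofReal_ne_top, ENNReal.one_ne_top⟩)⟩))
    have h2 : Filter.Tendsto (fun δ => ENNReal.ofReal δ +
        (2 * ENNReal.ofReal δ) ^ (1 - q) * (2 * L) ^ q) (𝓝[>] 0) (𝓝 0) := by
      have h3 := ((ENNReal.continuous_rpow_const (y := 1 - q)).tendsto _).comp
        (ENNReal.Tendsto.const_mul h0 (a := 2) (.inr ENNReal.ofNat_ne_top))
      have h4 : (2 * L) ^ q ≠ ⊤ := ENNReal.rpow_ne_top_of_nonneg hq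
        (ENNReal.mul_ne_top ENNReal.ofNat_ne_top ENNReal.ofReal_ne_top)
      have h5 := h0.add (ENNReal.Tendsto.mul_const h3 (b := (2 * L) ^ q) (.inr h4))
      -- Here `q < 1` is essential: the exponent `1 - q` must be positive.
      rw [mul_zero, ENNReal.zero_rpow_of_pos (by linarith), zero_mul, add_zero] at h5
      exact h5
    have h6 : ∀ᶠ δ : ℝ in 𝓝[>] 0, δ ∈ Ioo (0 : ℝ) 1 := Ioo_mem_nhdsGT one_pos
    obtain ⟨δ, hδ, h7, h8⟩ := (h6.and ((h1.eventually (gt_mem_nhds hε')).and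
      (h2.eventually (gt_mem_nhds hε')))).exists
    exact ⟨δ, hδ.1, hδ.2, h7.le, h8.le⟩
  -- The centres of the net are taken in the range of `Φ`, so they come from actual leaves and test
  -- functions.
  obtain ⟨t, ht, htf, hcov⟩ := Metric.finite_approx_of_totallyBounded hΦ δ hδ
  have := htf.to_subtype
  choose g hg using fun y : t => ht y.2
  refine ⟨(finite_range g).toFinset, fun p => ?_⟩
  obtain ⟨y, hy, hpy⟩ := mem_iUnion₂.1 (hcov (mem_range_self p))
  refine ⟨g ⟨y, hy⟩, by simp, ?_⟩
  rw [← show Φ (g ⟨y, hy⟩) = y from hg ⟨y, hy⟩, Metric.mem_ball] at hpy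
  obtain ⟨hj, hx, hr, hF⟩ := hclose _ _ (hpy.trans hδ1)
  exact ⟨(leafDist_le _ _ hj (hx.trans hpy.le) (hr.trans hpy.le)
      fun t ht => (hF t ht).1.trans hpy.le).trans hδε,
    (testDist_le hκ hq hq1.le _ _ fun t ht => (hF t ht).2.trans hpy.le).trans hδε'⟩

end LeafTest

end Setting

end

noncomputable section

/-! ### Comparison of the norms, semicontinuity and finite approximation. -/

section Setting

variable {H : Type*} [TopologicalSpace H] {I : ModelWithCorners ℝ Plane H}
  {M : Type*} [TopologicalSpace M] [ChartedSpace H M] [IsManifold I ∞ M]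
  [RiemannianBundle (fun x : M => TangentSpace I x)]
  {T : PiecewiseHyperbolicMap I M} {κ : ℝ} {A : LeafCharts T κ} {r₀ B α β q ε₀ b : ℝ}

namespace AdmissibleLeaf

variable (W : AdmissibleLeaf A r₀ B)

/-- Used to rescale a test function into the unit ball that defines a norm. -/
theorem enorm_integral_eq_mul (h φ : M → ℂ) {c : ℝ} (hc : 0 < c) :
    ‖W.integral h φ‖ₑ = ENNReal.ofReal c * ‖W.integral h (((c⁻¹ : ℝ) : ℂ) • φ)‖ₑ := by
  rw [integral_const_smul, enorm_mul, ← mul_assoc, ← ofReal_norm ((c⁻¹ : ℝ) : ℂ),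
    Complex.norm_of_nonneg (inv_pos.2 hc).le, ← ENNReal.ofReal_mul hc.le, mul_inv_cancel₀ hc.ne',
    ENNReal.ofReal_one, one_mul]

theorem enorm_inv_mul_le_one {c : ℝ} (hc : 0 < c) {a : ℝ≥0∞} (ha : a ≤ ENNReal.ofReal c) :
    ‖((c⁻¹ : ℝ) : ℂ)‖ₑ * a ≤ 1 := by
  rw [← ofReal_norm, Complex.norm_of_nonneg (inv_pos.2 hc).le]
  refine (mul_le_mul_right ha _).trans_eq ?_
  rw [← ENNReal.ofReal_mul (inv_pos.2 hc).le, inv_mul_cancel₀ hc.ne', ENNReal.ofReal_one]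

/-- Makes every leaf functional weakly continuous, however large the `C¹` norm of its test function.
The `+ 1` keeps the scaling factor positive when that norm is 0. -/
theorem enorm_integral_le_weakNorm {φ : M → ℂ} (hφ : φ ∈ W.c1Functions) (h : C1Space I M) :
    ‖W.integral h φ‖ₑ ≤ ENNReal.ofReal ((W.c1Norm φ).toReal + 1) * weakNorm A r₀ B h := by
  have hc : 0 < (W.c1Norm φ).toReal + 1 := by positivity
  rw [W.enorm_integral_eq_mul h φ hc]
  refine mul_le_mul_right ?_ _
  refine le_iSup_of_le W (le_iSup_of_le ⟨_, W.const_smul_mem_c1Functions _ hφ⟩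
    (le_iSup_of_le ?_ le_rfl))
  rw [c1Norm_const_smul]
  refine enorm_inv_mul_le_one hc (ENNReal.le_ofReal_iff_toReal_le hφ.2.ne hc.le |>.2 ?_)
  linarith

end AdmissibleLeaf

/-- The weak norm is dominated by the strong stable norm. -/
theorem exists_weakNorm_le_strongStableNorm (A : LeafCharts T κ) (r₀ B : ℝ) (hκ : 0 < κ)
    (hα : 0 ≤ α) (hq : 0 ≤ q) (hq1 : q ≤ 1) : ∃ C : ℝ≥0∞, C ≠ ⊤ ∧
      ∀ h : C1Space I M, weakNorm A r₀ B h ≤ C * strongStableNorm A r₀ B α q h := by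
  -- `K` bounds the strong test norm: maximal leaf length to the power `α`, times the Hölder bound
  -- 3.
  set K : ℝ≥0∞ := ENNReal.ofReal ((1 + κ) * (1 + κ) * (2 * r₀)) ^ α * 3
  have hK : K ≠ ⊤ := ENNReal.mul_ne_top (ENNReal.rpow_ne_top_of_nonneg hα ENNReal.ofReal_ne_top)
    ENNReal.ofNat_ne_top
  have hc : 0 < K.toReal + 1 := by positivity
  refine ⟨ENNReal.ofReal (K.toReal + 1), ENNReal.ofReal_ne_top, fun h =>
    iSup_le fun W => iSup_le fun φ => iSup_le fun hφ => ?_⟩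
  rw [W.enorm_integral_eq_mul h φ hc]
  refine mul_le_mul_right ?_ _
  refine le_iSup_of_le W (le_iSup_of_le ⟨_, W.const_smul_mem_c1Functions _ φ.2⟩
    (le_iSup_of_le ?_ le_rfl))
  rw [W.holderNorm_const_smul, mul_left_comm]
  refine AdmissibleLeaf.enorm_inv_mul_le_one hc ?_
  calc _ ≤ K := mul_le_mul' (ENNReal.rpow_le_rpow (W.length_le hκ) hα)
        (W.holderNorm_le φ.2 hφ hq hq1)
    _ = ENNReal.ofReal K.toReal := (ENNReal.ofReal_toReal hK).symm
    _ ≤ _ := ENNReal.ofReal_le_ofReal (by linarith)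

theorem le_strongUnstableNorm {ε : ℝ} (hε : ε ∈ Ioc 0 ε₀) {W₁ W₂ : AdmissibleLeaf A r₀ B}
    (hW : W₁.leafDist W₂ ≤ ENNReal.ofReal ε) (φ₁ : W₁.c1Functions) (φ₂ : W₂.c1Functions)
    (hφ₁ : W₁.c1Norm φ₁ ≤ 1) (hφ₂ : W₂.c1Norm φ₂ ≤ 1)
    (hφ : W₁.testDist W₂ q φ₁ φ₂ ≤ ENNReal.ofReal ε) (h : C1Space I M) :
    (ENNReal.ofReal ε ^ β)⁻¹ * ‖W₁.integral h φ₁ - W₂.integral h φ₂‖ₑ ≤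
      strongUnstableNorm A r₀ B β q ε₀ h :=
  le_iSup_of_le ε <| le_iSup_of_le hε <| le_iSup_of_le W₁ <| le_iSup_of_le W₂ <|
    le_iSup_of_le hW <| le_iSup_of_le φ₁ <| le_iSup_of_le φ₂ <| le_iSup_of_le hφ₁ <|
    le_iSup_of_le hφ₂ <| le_iSup_of_le hφ le_rfl

variable [CompactSpace M] [IsContMDiffRiemannianBundle I ∞ Plane (fun x : M => TangentSpace I x)]

/-- This covers the test functions of the strong stable norm, whose `C¹` norms are finite but not
uniformly bounded. -/
theorem tendsto_leafFunctional (hκ : 0 < κ) (W : AdmissibleLeaf A r₀ B) (φ : W.c1Functions)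
    {x : ℕ → C1Space I M} {y : C1Space I M}
    (hxy : Filter.Tendsto (fun n => weakNorm A r₀ B (x n - y)) .atTop (𝓝 0)) :
    Filter.Tendsto (fun n => W.integral (x n) φ) .atTop (𝓝 (W.integral y φ)) := by
  rw [tendsto_iff_edist_tendsto_0]
  have h0 := ENNReal.Tendsto.const_mul hxy
    (a := ENNReal.ofReal ((W.c1Norm φ).toReal + 1)) (.inr ENNReal.ofReal_ne_top)
  rw [mul_zero] at h0
  refine tendsto_of_tendsto_of_tendsto_of_le_of_le tendsto_const_nhds h0 (fun _ => zero_le)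
    fun n => ?_
  have h1 := W.enorm_integral_le_weakNorm φ.2 (x n - y)
  rw [edist_eq_enorm_sub]
  exact (congrArg _ ((leafFunctional hκ W φ).map_sub (x n) y)).symm.trans_le h1

/-- The strong norm is lower semicontinuous, up to a factor, in the weak topology. -/
theorem strongNorm_le_of_tendsto (hκ : 0 < κ) (hb : 0 < b)
    (x : ℕ → C1Space I M) (y : C1Space I M) (c : ℝ≥0∞)
    (hxy : Filter.Tendsto (fun n => weakNorm A r₀ B (x n - y)) .atTop (𝓝 0))
    (hx : ∀ᶠ n in .atTop, strongNorm A r₀ B α β q ε₀ b (x n) ≤ c) :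
    strongNorm A r₀ B α β q ε₀ b y ≤ 2 * c := by
  have hb' : ENNReal.ofReal b ≠ 0 := (ENNReal.ofReal_pos.2 hb).ne'
  rw [two_mul]
  -- The factor 2 arises because the stable and the weighted unstable part are each bounded by `c`
  -- separately.
  refine add_le_add (iSup_le fun W => iSup_le fun φ => iSup_le fun hφ => ?_) ?_
  · refine le_of_tendsto (tendsto_leafFunctional hκ W φ hxy).enorm (hx.mono fun n hn => ?_)
    exact (le_iSup_of_le W <| le_iSup_of_le φ <| le_iSup_of_le hφ le_rfl :
      _ ≤ strongStableNorm A r₀ B α q (x n)).trans (le_self_add.trans hn)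
  · rw [mul_comm, ← ENNReal.le_div_iff_mul_le (.inl hb') (.inl ENNReal.ofReal_ne_top)]
    refine iSup_le fun ε => iSup_le fun hε => iSup_le fun W₁ => iSup_le fun W₂ => iSup_le fun hW =>
      iSup_le fun φ₁ => iSup_le fun φ₂ => iSup_le fun hφ₁ => iSup_le fun hφ₂ => iSup_le fun hφ => ?_
    have hε' : (ENNReal.ofReal ε ^ β)⁻¹ ≠ ⊤ := ENNReal.inv_ne_top.2
      (ENNReal.rpow_pos (ENNReal.ofReal_pos.2 hε.1) ENNReal.ofReal_ne_top).ne'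
    refine le_of_tendsto (ENNReal.Tendsto.const_mul ((tendsto_leafFunctional hκ W₁ φ₁ hxy).sub
      (tendsto_leafFunctional hκ W₂ φ₂ hxy)).enorm (.inr hε')) (hx.mono fun n hn => ?_)
    refine (le_strongUnstableNorm hε hW φ₁ φ₂ hφ₁ hφ₂ hφ (x n)).trans ?_
    rw [ENNReal.le_div_iff_mul_le (.inl hb') (.inl ENNReal.ofReal_ne_top), mul_comm]
    exact le_add_self.trans hn

/-- Up to a small multiple of the strong norm, the weak norm is controlled by the integrals over
finitely many leaves. -/
theorem exists_finset_weakNorm_le (hκ : 0 < κ) (hβ : 0 < β) (hq : 0 ≤ q) (hq1 : q < 1)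
    (hε₀ : 0 < ε₀) (hb : 0 < b) {η : ℝ} (hη : 0 < η) :
    ∃ s : Finset (C1Space I M →ₗ[ℂ] ℂ), (∀ l ∈ s, ∀ h, ‖l h‖ₑ ≤ weakNorm A r₀ B h) ∧
      ∀ h, weakNorm A r₀ B h ≤
        (⨆ l ∈ s, ‖l h‖ₑ) + ENNReal.ofReal η * strongNorm A r₀ B α β q ε₀ b h := by
  classical
  -- The second entry gives `ε ^ β ≤ η * b`, which absorbs the weight `b` of the unstable norm; the
  -- first keeps `ε` in the range over which that norm is taken.
  set ε := min ε₀ ((η * b) ^ β⁻¹)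
  have hε : 0 < ε := lt_min hε₀ (Real.rpow_pos_of_pos (by positivity) _)
  have hεβ : ENNReal.ofReal ε ^ β ≤ ENNReal.ofReal η * ENNReal.ofReal b := by
    rw [← ENNReal.ofReal_mul hη.le, ENNReal.ofReal_rpow_of_pos hε]
    refine ENNReal.ofReal_le_ofReal ?_
    refine (Real.rpow_le_rpow hε.le (min_le_right _ _) hβ.le).trans_eq ?_
    exact Real.rpow_inv_rpow (by positivity) hβ.ne'
  have hε0 : ENNReal.ofReal ε ^ β ≠ 0 :=
    (ENNReal.rpow_pos (ENNReal.ofReal_pos.2 hε) ENNReal.ofReal_ne_top).ne'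
  have hεt : ENNReal.ofReal ε ^ β ≠ ⊤ := ENNReal.rpow_ne_top_of_nonneg hβ.le ENNReal.ofReal_ne_top
  obtain ⟨s, hs⟩ := LeafTest.exists_finite_net (A := A) (r₀ := r₀) (B := B) hκ hq hq1 hε
  refine ⟨s.image fun p => leafFunctional hκ p.1 p.2.1, fun l hl h => ?_, fun h => ?_⟩
  · obtain ⟨p, -, rfl⟩ := Finset.mem_image.1 hl
    exact le_iSup_of_le p.1 <| le_iSup_of_le p.2.1 <| le_iSup_of_le p.2.2 le_rfl
  · refine iSup_le fun W => iSup_le fun φ => iSup_le fun hφ => ?_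
    -- The pair is replaced by a close one from the net, and the unstable norm bounds the difference
    -- of the two integrals.
    obtain ⟨p, hp, hW, hφp⟩ := hs ⟨W, φ, hφ⟩
    have h1 := le_strongUnstableNorm (ε₀ := ε₀) (β := β) ⟨hε, min_le_left _ _⟩ hW φ p.2.1 hφ p.2.2
      hφp h
    have h2 : ‖W.integral h φ‖ₑ ≤ ‖p.1.integral h p.2.1‖ₑ +
        ‖W.integral h φ - p.1.integral h p.2.1‖ₑ := by
      refine le_trans (le_of_eq ?_) (enorm_add_le _ _)
      rw [add_sub_cancel]
    refine h2.trans (add_le_add ?_ ?_)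
    · exact le_iSup₂_of_le (leafFunctional hκ p.1 p.2.1) (Finset.mem_image_of_mem _ hp) le_rfl
    · rw [mul_comm, ← div_eq_mul_inv, ENNReal.div_le_iff hε0 hεt, mul_comm] at h1
      calc _ ≤ ENNReal.ofReal ε ^ β * strongUnstableNorm A r₀ B β q ε₀ h := h1
        _ ≤ ENNReal.ofReal η * ENNReal.ofReal b * strongUnstableNorm A r₀ B β q ε₀ h := by gcongr
        _ ≤ _ := by
          rw [mul_assoc]
          exact mul_le_mul_right le_add_self _

end Setting

end

/-- Let `M` be a compact Riemannian surface, possibly with boundary (and corners) and not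
necessarily connected, `T` a piecewise hyperbolic map of `M`, `A` a finite family of charts adapted
to its stable direction, and let `𝓑`, `𝓑_w` be the completions of `C¹(M, ℂ)` in the strong and weak
norms. Then the identity of `C¹(M, ℂ)` extends to a continuous injection `𝓑 → 𝓑_w`, and the image of
the closed unit ball of `𝓑` is relatively compact in `𝓑_w`. -/
theorem lemma3p5 {H : Type*} [TopologicalSpace H] {I : ModelWithCorners ℝ Plane H}
    {M : Type*} [TopologicalSpace M] [T2Space M] [CompactSpace M] [ChartedSpace H M]
    [IsManifold I ∞ M] [RiemannianBundle (fun x : M => TangentSpace I x)]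
    [IsContMDiffRiemannianBundle I ∞ Plane (fun x : M => TangentSpace I x)]
    {T : PiecewiseHyperbolicMap I M} {κ : ℝ} (hκ : 0 < κ) (A : LeafCharts T κ)
    {r₀ B : ℝ} (hr₀ : 0 < r₀) (hr₀' : ∀ j, r₀ ≤ A.radius j / 2) (hB : 0 < B)
    {α β q : ℝ} (hβ : 0 < β) (hβα : β ≤ α) (hα : α < 1) (hq : 0 ≤ q) (hαq : α ≤ 1 - q)
    {ε₀ b : ℝ} (hε₀ : 0 < ε₀) (hb : 0 < b) :
    ∃ ι : LeafStrongSpace A r₀ B α β q ε₀ b hκ →L[ℂ] LeafWeakSpace A r₀ B hκ,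
      (∀ (h : C1Space I M) (hs : strongNorm A r₀ B α β q ε₀ b h < ⊤),
        ∃ hw : weakNorm A r₀ B h < ⊤,
          ι (((isExtSeminorm_strongNorm A r₀ B α β q ε₀ b hκ).toFinitePart h hs :
              (isExtSeminorm_strongNorm A r₀ B α β q ε₀ b hκ).FinitePart) :
              LeafStrongSpace A r₀ B α β q ε₀ b hκ) =
            (((isExtSeminorm_weakNorm A r₀ B hκ).toFinitePart h hw :
              (isExtSeminorm_weakNorm A r₀ B hκ).FinitePart) : LeafWeakSpace A r₀ B hκ)) ∧
      Function.Injective ι ∧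
      IsCompact (closure (ι '' Metric.closedBall 0 1)) := by
  obtain ⟨C, hC, hCle⟩ := exists_weakNorm_le_strongStableNorm (α := α) (q := q) A r₀ B hκ
    (by linarith) hq (by linarith)
  have hle : ∀ h, weakNorm A r₀ B h ≤ C * strongNorm A r₀ B α β q ε₀ b h := fun h =>
    (hCle h).trans (mul_le_mul_right le_self_add _)
  have hN := isExtSeminorm_strongNorm A r₀ B α β q ε₀ b hκ
  have hN' := isExtSeminorm_weakNorm A r₀ B hκ
  refine ⟨(hN.inclusion hN' hC hle).completion, fun h hs =>
    ⟨(hle h).trans_lt (ENNReal.mul_lt_top hC.lt_top hs), ?_⟩, ?_, ?_⟩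
  · exact ContinuousLinearMap.completion_apply_coe _ _
  · exact hN.injective_completion_inclusion hN' hC hle ENNReal.ofNat_ne_top
      (strongNorm_le_of_tendsto hκ hb)
  -- The strict inequality `q < 1` follows from `0 < β ≤ α ≤ 1 - q`.
  · exact hN.isCompact_closure_completion_inclusion hN' hC hle fun η hη =>
      exists_finset_weakNorm_le hκ hβ hq (by linarith) hε₀ hb hη
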